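/- **Notation.** $\mathbb N=\{1,2,\dots\}$, $\mathbb N_0=\mathbb N\cup\{0\}$; for $x\in\mathbb R^n$ let $\lVert x\rVert_1=\sum_i|x_i|$ and $\lVert x\rVert_\infty=\max_i|x_i|$; $\mathbb 1_{S}$ is the indicator function of $S$. For $\theta\in\mathbb R^{\mathbf d}$, $m,n\in\mathbb N$, $s\in\mathbb N_0$ with $\mathbf d\ge s+mn+m$ let $\mathcal A^{\theta,s}_{m,n}\colon\mathbb R^n\to\mathbb R^m$ be the affine function whose $i$-th component is $x\mapsto\bigl[\sum_{j=1}^n\theta_{s+(i-1)n+j}x_j\bigr]+\theta_{s+mn+i}$. For $\mathbf l=(\mathbf l_0,\dots,\mathbf l_{\mathbf L})\in\mathbb N^{\mathbf L+1}$, real $u<v$, and $\theta\in\mathbb R^{\mathbf d}$ with $\mathbf d\ge\sum_{i=1}^{\mathbf L}\mathbf l_i(\mathbf l_{i-1}+1)$, the rectified clipped network is $$\mathscr N^{\theta,\mathbf l}_{u,v}=\mathfrak a_{\mathbf L}\circ\mathcal A^{\theta,s_{\mathbf L}}_{\mathbf l_{\mathbf L},\mathbf l_{\mathbf L-1}}\circ\dots\circ\mathfrak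 a_1\circ\mathcal A^{\theta,s_1}_{\mathbf l_1,\mathbf l_0}\colon\mathbb R^{\mathbf l_0}\to\mathbb R^{\mathbf l_{\mathbf L}},\qquad s_k=\sum_{i=1}^{k-1}\mathbf l_i(\mathbf l_{i-1}+1),$$ where $\mathfrak a_i$ applies $x\mapsto\max\{x,0\}$ componentwise for $i<\mathbf L$ and $\mathfrak a_{\mathbf L}$ applies $x\mapsto\max\{u,\min\{x,v\}\}$ componentwise. **Theorem.** Let $d,\mathbf d,\mathbf L,M,K,N\in\mathbb N$, $A\in(0,\infty)$, $L,a,u\in\mathbb R$, $b\in(a,\infty)$, $v\in(u,\infty)$, $c\in[\max\{1,L,|a|,|b|,2|u|,2|v|\},\infty)$, $B\in[c,\infty)$, $\mathbf l=(\mathbf l_0,\dots,\mathbf l_{\mathbf L})\in\mathbb N^{\mathbf L+1}$, $\mathbf N\subseteq\{0,1,\dots,N\}$. Assume $0\in\mathbf N$, $\mathbf L\ge A\,\mathbb 1_{(6^d,\infty)}(A)/(2d)+1$, $\mathbf l_0=d$, $\mathbf l_1\ge A\,\mathbb 1_{(6^d,\infty)}(A)$, $\mathbf l_{\mathbf L}=1$,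 $\mathbf d\ge\sum_{i=1}^{\mathbf L}\mathbf l_i(\mathbf l_{i-1}+1)$, and $\mathbf l_i\ge\mathbb 1_{(6^d,\infty)}(A)\max\{A/d-2i+3,2\}$ for all integers $i$ with $2\le i<\mathbf L$. Let $(\Omega,\mathcal F,\mathbb P)$ be a probability space, let $X_j\colon\Omega\to[a,b]^d$ and $Y_j\colon\Omega\to[u,v]$, $j\in\mathbb N$, be functions such that $(X_j,Y_j)$, $j\in\{1,\dots,M\}$, are i.i.d. random variables, and let $\mathcal E\colon[a,b]^d\to[u,v]$ satisfy $\mathcal E(X_1)=\mathbb E[Y_1\mid X_1]$ $\mathbb P$-a.s. and $|\mathcal E(x)-\mathcal E(y)|\le L\lVert x-y\rVert_1$ for all $x,y\in[a,b]^d$. Let $\Theta_{k,n}\colon\Omega\to\mathbb R^{\mathbf d}$, $k,n\in\mathbb N_0$, and $\mathbf k\colon\Omega\to(\mathbb N_0)^2$ be random variables. Assume that $\Theta_{k,0}(\Omega)\subseteq[-B,B]^{\mathbf d}$ for all $k\in\mathbb N$, that $\Theta_{k,0}$, $k\in\{1,\dots,K\}$, are i.i.d., and that $\Theta_{1,0}$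 is uniformly distributed on $[-c,c]^{\mathbf d}$. For $\theta\in\mathbb R^{\mathbf d}$, $\omega\in\Omega$ let $\mathcal R(\theta,\omega)=\frac1M\sum_{j=1}^M|\mathscr N^{\theta,\mathbf l}_{u,v}(X_j(\omega))-Y_j(\omega)|^2$, and assume for all $\omega\in\Omega$ that $\mathbf k(\omega)$ is a minimiser of $(k,n)\mapsto\mathcal R(\Theta_{k,n}(\omega),\omega)$ over the set of all $(k,n)\in\{1,\dots,K\}\times\mathbf N$ with $\lVert\Theta_{k,n}(\omega)\rVert_\infty\le B$. Then the overall error $\omega\mapsto\int_{[a,b]^d}|\mathscr N^{\Theta_{\mathbf k(\omega)}(\omega),\mathbf l}_{u,v}(x)-\mathcal E(x)|^2\,\mathbb P_{X_1}(\mathrm dx)$ is well defined and measurable, where $\mathbb P_{X_1}$ is the law of $X_1$; its $p$-th power is integrable for all $p\in(0,\infty)$; and for all $p\in(0,\infty)$ it holds that $$\begin{aligned}&\Bigl(\mathbb E\Bigl[\Bigl(\int_{[a,b]^d}|\mathscr N^{\Theta_{\mathbf k},\mathbf l}_{u,v}(x)-\mathcal E(x)|^2\,\mathbb P_{X_1}(\mathrm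 dx)\Bigr)^p\Bigr]\Bigr)^{1/p}\\&\le\frac{9d^2L^2(b-a)^2}{A^{2/d}}+\frac{4(v-u)\mathbf L(\lVert\mathbf l\rVert_\infty+1)^{\mathbf L}c^{\mathbf L+1}\max\{1,p\}}{K^{[\mathbf L^{-1}(\lVert\mathbf l\rVert_\infty+1)^{-2}]}}\\&\quad+\frac{18\max\{1,(v-u)^2\}\mathbf L(\lVert\mathbf l\rVert_\infty+1)^2\max\{p,\ln(3MBc)\}}{\sqrt M}\\&\le\frac{36d^2c^4}{A^{2/d}}+\frac{4\mathbf L(\lVert\mathbf l\rVert_\infty+1)^{\mathbf L}c^{\mathbf L+2}\max\{1,p\}}{K^{[\mathbf L^{-1}(\lVert\mathbf l\rVert_\infty+1)^{-2}]}}+\frac{23B^3\mathbf L(\lVert\mathbf l\rVert_\infty+1)^2\max\{p,\ln(eM)\}}{\sqrt M}.\end{aligned}$$ -/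

import Mathlib

open MeasureTheory ProbabilityTheory

noncomputable section

namespace ClippedDNN

/-- The hypercube `[a, b]^d`. -/
abbrev cube (d : ℕ) (a b : ℝ) : Set (Fin d → ℝ) :=
  Set.Icc (fun _ => a) (fun _ => b)

/-- The entry of the vector `θ = (θ_1, …, θ_D)` with zero-based index `k`, i.e. `θ_{k+1}`
(the value `0` for `k ≥ D` is never used when `D` is at least the number of parameters). -/
def param {D : ℕ} (θ : Fin D → ℝ) (k : ℕ) : ℝ :=
  if h : k < D then θ ⟨k, h⟩ else 0

/-- The affine map `ℝ^n → ℝ^m` whose weight matrix is stored row by row in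
`θ_{s+1}, …, θ_{s+mn}` and whose bias is `(θ_{s+mn+1}, …, θ_{s+mn+m})`. -/
def affine {D : ℕ} (m n : ℕ) (θ : Fin D → ℝ) (s : ℕ) (x : Fin n → ℝ) : Fin m → ℝ :=
  fun i => (∑ j : Fin n, param θ (s + (i : ℕ) * n + j) * x j) + param θ (s + m * n + i)

/-- `∑_{i=1}^{k} l_i (l_{i-1} + 1)`, the number of parameters of the first `k` layers. -/
def numParams (l : ℕ → ℕ) (k : ℕ) : ℕ :=
  ∑ i ∈ Finset.Icc 1 k, l i * (l (i - 1) + 1)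

/-- The fully connected feedforward network with layer widths `l 0, …, l k`, activation functions
`act 1, …, act k`, and parameters read from `θ` starting after position `s`:
`act k ∘ A_k ∘ act (k-1) ∘ A_{k-1} ∘ … ∘ act 1 ∘ A_1`. -/
def network {D : ℕ} (l : ℕ → ℕ) (act : (i : ℕ) → (Fin (l i) → ℝ) → Fin (l i) → ℝ)
    (θ : Fin D → ℝ) (s : ℕ) : (k : ℕ) → (Fin (l 0) → ℝ) → Fin (l k) → ℝ
  | 0, x => x
  | k + 1, x =>
      act (k + 1) (affine (l (k + 1)) (l k) θ (s + numParams l k) (network l act θ s k x))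

/-- The rectifier function. -/
def rect (x : ℝ) : ℝ := max x 0

/-- The clipping function. -/
def clip (u v x : ℝ) : ℝ := max u (min x v)

/-- The rectified clipped network of depth `depth` with layer widths `l 0, …, l depth`: the
rectifier acts componentwise on the hidden layers, the clipping function on the output layer.
Only the values `l 0, …, l depth` of `l` matter. -/
def clippedNN {D : ℕ} (depth : ℕ) (l : ℕ → ℕ) (u v : ℝ) (θ : Fin D → ℝ) :
    (Fin (l 0) → ℝ) → Fin (l depth) → ℝ :=
  network l (fun i x j => if i = depth then clip u v (x j) else rect (x j)) θ 0 depth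

/-- The rectified clipped network regarded as a function `ℝ^d → ℝ` when `l 0 = d` and
`l depth = 1`. -/
def realNN {D d depth : ℕ} {l : ℕ → ℕ} (h0 : l 0 = d) (h1 : l depth = 1) (u v : ℝ)
    (θ : Fin D → ℝ) (x : Fin d → ℝ) : ℝ :=
  clippedNN depth l u v θ (fun i => x (Fin.cast h0 i)) (Fin.cast h1.symm 0)

/-- `‖(l_0, …, l_depth)‖_∞`. -/
def maxWidth (depth : ℕ) (l : ℕ → ℕ) : ℕ :=
  (Finset.range (depth + 1)).sup l

/-- The squared `L²`-distance `∫_{[a,b]^d} |N_θ(x) - E(x)|² μ(dx)` of a network with parameter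
vector `θ` from a function `E`. -/
def sqError {D d depth : ℕ} {l : ℕ → ℕ} (h0 : l 0 = d) (h1 : l depth = 1) {a b u v : ℝ}
    (E : cube d a b → Set.Icc u v) (μ : Measure (cube d a b)) (θ : Fin D → ℝ) : ℝ :=
  ∫ x, |realNN h0 h1 u v θ x - (E x : ℝ)| ^ 2 ∂μ

end ClippedDNN

end

open ClippedDNN

/-! Since `E (X 1)` is the conditional expectation of `Y 1`, the squared `L²` distance from a
predictor to `E` is its risk minus a constant, so excess risks can be compared through empirical
risks. This bounds the overall error of the selected network by three terms, for any fixed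
reference parameter `ϑ`.

* Approximation: the error of the network with parameter `ϑ`. A Lipschitz function is the maximum
  of the cones `y ↦ E x - L ‖y - x‖₁` over the points `x` of a grid up to an error controlled by the
  mesh, and this maximum is realised exactly by a ReLU network of width and depth about `A`.
* Generalization: twice the supremum over all parameters of the deviation of empirical from true
  risk. Hoeffding's inequality gives a subgaussian moment bound at the points of a finite net of the
  parameter cube, a union bound gives it for the maximum over the net, and the networks are
  Lipschitz in their parameters.
* Optimization: the minimum over the `K` uniform initialisations of the distance to `ϑ`, whose tail
  is `(1 - (r / 2c) ^ n) ^ K` for `n` parameters.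
-/

namespace ClippedDNN

section Network

lemma numParams_succ (l : ℕ → ℕ) (k : ℕ) :
    numParams l (k + 1) = numParams l k + l (k + 1) * (l k + 1) := by
  simp [numParams, Finset.sum_Icc_succ_top]

lemma numParams_mono (l : ℕ → ℕ) : Monotone (numParams l) :=
  monotone_nat_of_le_succ fun k => by rw [numParams_succ]; exact Nat.le_add_right _ _

lemma le_maxWidth {depth k : ℕ} (l : ℕ → ℕ) (hk : k ≤ depth) : l k ≤ maxWidth depth l :=
  Finset.le_sup (f := l) (Finset.mem_range.2 (Nat.lt_succ_of_le hk))

lemma one_le_numParams {l : ℕ → ℕ} {depth : ℕ} (h1 : l depth = 1) (hdepth : 1 ≤ depth) :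
    1 ≤ numParams l depth := by
  obtain ⟨k, rfl⟩ := Nat.exists_eq_add_of_le' hdepth
  rw [numParams_succ, h1]
  omega

lemma numParams_le (l : ℕ → ℕ) (depth : ℕ) :
    numParams l depth ≤ depth * (maxWidth depth l * (maxWidth depth l + 1)) :=
  calc numParams l depth
      ≤ ∑ _i ∈ Finset.Icc 1 depth, maxWidth depth l * (maxWidth depth l + 1) := by
        refine Finset.sum_le_sum fun i hi => ?_
        have hi' : i ≤ depth := (Finset.mem_Icc.1 hi).2
        exact Nat.mul_le_mul (le_maxWidth l hi') (Nat.succ_le_succ (le_maxWidth l (by omega)))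
    _ = depth * (maxWidth depth l * (maxWidth depth l + 1)) := by simp

lemma row_major_lt {m n i j : ℕ} (hi : i < m) (hj : j < n) : i * n + j < m * n := by
  have : (i + 1) * n ≤ m * n := Nat.mul_le_mul_right n hi
  nlinarith

variable {D m n s : ℕ} {θ ϑ : Fin D → ℝ}

lemma weight_index_lt (s : ℕ) (i : Fin m) (j : Fin n) : s + (i : ℕ) * n + j < s + m * (n + 1) := by
  have := row_major_lt i.2 j.2
  linarith

lemma bias_index_lt (s n : ℕ) (i : Fin m) : s + m * n + i < s + m * (n + 1) := by
  have := i.2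
  linarith

lemma abs_param_le {c : ℝ} (hc : 0 ≤ c) (h : ∀ i, |θ i| ≤ c) (k : ℕ) : |param θ k| ≤ c := by
  unfold param
  split_ifs
  exacts [h _, by simpa using hc]

lemma continuous_param (k : ℕ) : Continuous fun θ : Fin D → ℝ => param θ k := by
  unfold param
  split_ifs <;> fun_prop

lemma abs_affine_le {β r : ℝ} (hβ : 0 ≤ β) (hθ : ∀ t < s + m * (n + 1), |param θ t| ≤ β)
    {x : Fin n → ℝ} (hx : ∀ j, |x j| ≤ r) (i : Fin m) :
    |affine m n θ s x i| ≤ n * (β * r) + β := by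
  refine (abs_add_le _ _).trans (add_le_add ?_ (hθ _ (bias_index_lt s n i)))
  calc |∑ j : Fin n, param θ (s + i * n + j) * x j|
      ≤ ∑ j : Fin n, |param θ (s + i * n + j) * x j| := Finset.abs_sum_le_sum_abs _ _
    _ ≤ ∑ _j : Fin n, β * r := Finset.sum_le_sum fun j _ => by
        rw [abs_mul]
        exact mul_le_mul (hθ _ (weight_index_lt s i j)) (hx j) (abs_nonneg _) hβ
    _ = n * (β * r) := by simp

lemma abs_affine_sub_affine_le {β r δ ε : ℝ} (hβ : 0 ≤ β) (hδ : 0 ≤ δ)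
    (hϑ : ∀ t < s + m * (n + 1), |param ϑ t| ≤ β)
    (hθϑ : ∀ t < s + m * (n + 1), |param θ t - param ϑ t| ≤ δ)
    {x y : Fin n → ℝ} (hx : ∀ j, |x j| ≤ r) (hxy : ∀ j, |x j - y j| ≤ ε) (i : Fin m) :
    |affine m n θ s x i - affine m n ϑ s y i| ≤ n * (β * ε + δ * r) + δ := by
  unfold affine
  rw [add_sub_add_comm, ← Finset.sum_sub_distrib]
  refine (abs_add_le _ _).trans (add_le_add ?_ (hθϑ _ (bias_index_lt s n i)))
  refine (Finset.abs_sum_le_sum_abs _ _).trans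
    ((Finset.sum_le_card_nsmul _ _ (β * ε + δ * r) fun j _ => ?_).trans (by simp [mul_add]))
  have ht := weight_index_lt s i j
  set p := param θ (s + i * n + j)
  set q := param ϑ (s + i * n + j)
  calc |p * x j - q * y j| = |q * (x j - y j) + (p - q) * x j| := by ring_nf
    _ ≤ |q| * |x j - y j| + |p - q| * |x j| := by
        rw [← abs_mul, ← abs_mul]
        exact abs_add_le _ _
    _ ≤ β * ε + δ * r := by
        gcongr
        exacts [hϑ _ ht, hxy j, hθϑ _ ht, hx j]

variable {l : ℕ → ℕ} {act : (i : ℕ) → (Fin (l i) → ℝ) → Fin (l i) → ℝ} {k w : ℕ}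
  {x : Fin (l 0) → ℝ}

lemma abs_network_le {β c : ℝ} (hact : ∀ n ≤ k, ∀ y j, |act n y j| ≤ |y j|)
    (hw : ∀ n < k, l n ≤ w) (hβ : 1 ≤ β) (hc : 1 ≤ c)
    (hθ : ∀ t < s + numParams l k, |param θ t| ≤ β) (hx : ∀ i, |x i| ≤ c) (i : Fin (l k)) :
    |network l act θ s k x i| ≤ c * ((w : ℝ) + 1) ^ k * β ^ k := by
  induction k with
  | zero => simpa [network] using hx i
  | succ k ih =>
    rw [numParams_succ, ← add_assoc] at hθ
    set r := c * ((w : ℝ) + 1) ^ k * β ^ k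
    have hr : 1 ≤ r := one_le_mul_of_one_le_of_one_le
      (one_le_mul_of_one_le_of_one_le hc (one_le_pow₀ (by simp))) (one_le_pow₀ hβ)
    have hprev (j : Fin (l k)) : |network l act θ s k x j| ≤ r :=
      ih (fun n hn => hact n (by omega)) (fun n hn => hw n (by omega))
        (fun t ht => hθ t (by omega)) j
    have hwk : (l k : ℝ) ≤ w := by exact_mod_cast hw k k.lt_succ_self
    calc |network l act θ s (k + 1) x i|
        ≤ l k * (β * r) + β := (hact _ le_rfl _ _).trans
          (abs_affine_le (zero_le_one.trans hβ) hθ hprev i)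
      _ ≤ w * (β * r) + β * r := by
          gcongr
          exact le_mul_of_one_le_right (by positivity) hr
      _ = c * ((w : ℝ) + 1) ^ (k + 1) * β ^ (k + 1) := by simp only [r]; ring

lemma abs_network_sub_network_le {β c δ : ℝ} (hact : ∀ n < k, ∀ y j, |act n y j| ≤ |y j|)
    (hactL : ∀ n ≤ k, ∀ y z j, |act n y j - act n z j| ≤ |y j - z j|)
    (hw : ∀ n < k, l n ≤ w) (hβ : 1 ≤ β) (hc : 1 ≤ c) (hδ : 0 ≤ δ)
    (hθ : ∀ t < s + numParams l k, |param θ t| ≤ β)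
    (hϑ : ∀ t < s + numParams l k, |param ϑ t| ≤ β)
    (hθϑ : ∀ t < s + numParams l k, |param θ t - param ϑ t| ≤ δ)
    (hx : ∀ i, |x i| ≤ c) (i : Fin (l k)) :
    |network l act θ s k x i - network l act ϑ s k x i|
      ≤ k * c * ((w : ℝ) + 1) ^ k * β ^ (k - 1) * δ := by
  induction k with
  | zero => simp [network]
  | succ k ih =>
    have hmono : s + numParams l k ≤ s + numParams l (k + 1) :=
      Nat.add_le_add_left (numParams_mono l k.le_succ) s
    set r := c * ((w : ℝ) + 1) ^ k * β ^ k with hr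
    have hr1 : 1 ≤ r := one_le_mul_of_one_le_of_one_le
      (one_le_mul_of_one_le_of_one_le hc (one_le_pow₀ (by simp))) (one_le_pow₀ hβ)
    set ε := k * c * ((w : ℝ) + 1) ^ k * β ^ (k - 1) * δ
    have hprev (j : Fin (l k)) : |network l act θ s k x j - network l act ϑ s k x j| ≤ ε :=
      ih (fun n hn => hact n (by omega)) (fun n hn => hactL n (by omega))
        (fun n hn => hw n (by omega)) (fun t ht => hθ t (by omega)) (fun t ht => hϑ t (by omega))
        (fun t ht => hθϑ t (by omega)) j
    have hbound (j : Fin (l k)) : |network l act θ s k x j| ≤ r :=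
      abs_network_le (fun n hn => hact n (by omega)) (fun n hn => hw n (by omega)) hβ hc
        (fun t ht => hθ t (by omega)) hx j
    have hwk : (l k : ℝ) ≤ w := by exact_mod_cast hw k k.lt_succ_self
    have hβε : β * ε = k * r * δ := by
      rcases k with _ | k
      · simp [ε]
      · simp only [ε, hr, Nat.add_sub_cancel]
        ring
    rw [numParams_succ, ← add_assoc] at hϑ hθϑ
    calc |network l act θ s (k + 1) x i - network l act ϑ s (k + 1) x i|
        ≤ l k * (β * ε + δ * r) + δ := (hactL _ le_rfl _ _ _).trans
          (abs_affine_sub_affine_le (by positivity) hδ hϑ hθϑ hbound hprev i)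
      _ ≤ w * (k * r * δ + δ * r) + (k * r * δ + δ * r) := by
          have : δ ≤ δ * r := le_mul_of_one_le_right hδ hr1
          rw [hβε]
          gcongr
          exact this.trans (le_add_of_nonneg_left (by positivity))
      _ = (k + 1 : ℕ) * c * ((w : ℝ) + 1) ^ (k + 1) * β ^ (k + 1 - 1) * δ := by
          simp only [hr, Nat.add_sub_cancel]
          push_cast
          ring

lemma continuous_network (hact : ∀ i, Continuous (act i)) (s k : ℕ) :
    Continuous fun q : (Fin D → ℝ) × (Fin (l 0) → ℝ) => network l act q.1 s k q.2 := by
  induction k with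
  | zero => exact continuous_snd
  | succ k ih =>
    refine (hact _).comp (continuous_pi fun i => ?_)
    have hparam (t : ℕ) : Continuous fun q : (Fin D → ℝ) × (Fin (l 0) → ℝ) => param q.1 t :=
      (continuous_param t).comp continuous_fst
    exact (continuous_finsetSum _ fun j _ => (hparam _).mul ((continuous_apply j).comp ih)).add
      (hparam _)

end Network

section ClippedNetwork

lemma rect_nonneg (x : ℝ) : 0 ≤ rect x := le_max_right _ _

lemma rect_of_nonneg {x : ℝ} (hx : 0 ≤ x) : rect x = x := max_eq_left hx

lemma abs_rect_le (x : ℝ) : |rect x| ≤ |x| := by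
  rw [abs_of_nonneg (rect_nonneg x)]
  exact max_le (le_abs_self x) (abs_nonneg x)

lemma abs_rect_sub_rect_le (x y : ℝ) : |rect x - rect y| ≤ |x - y| :=
  abs_max_sub_max_le_abs x y 0

lemma clip_mem_Icc {u v : ℝ} (huv : u ≤ v) (x : ℝ) : clip u v x ∈ Set.Icc u v :=
  ⟨le_max_left _ _, max_le huv (min_le_right _ _)⟩

lemma clip_of_mem_Icc {u v x : ℝ} (hx : x ∈ Set.Icc u v) : clip u v x = x := by
  rw [clip, min_eq_left hx.2, max_eq_right hx.1]

lemma abs_clip_sub_clip_le (u v x y : ℝ) : |clip u v x - clip u v y| ≤ |x - y| := by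
  unfold clip
  rw [max_comm u, max_comm u]
  exact (abs_max_sub_max_le_abs _ _ u).trans (by simpa using abs_min_sub_min_le_max x v y v)

/-- The activation functions of the rectified clipped network: clipping in layer `depth`, the
rectifier in all other layers. -/
def clipAct (depth : ℕ) (l : ℕ → ℕ) (u v : ℝ) (i : ℕ) (x : Fin (l i) → ℝ) (j : Fin (l i)) : ℝ :=
  if i = depth then clip u v (x j) else rect (x j)

variable {D d depth : ℕ} {l : ℕ → ℕ} {u v : ℝ} {θ ϑ : Fin D → ℝ}

lemma clippedNN_eq_network : clippedNN depth l u v θ = network l (clipAct depth l u v) θ 0 depth :=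
  rfl

lemma clipAct_of_lt {i : ℕ} (hi : i < depth) (x : Fin (l i) → ℝ) (j : Fin (l i)) :
    clipAct depth l u v i x j = rect (x j) :=
  if_neg hi.ne

lemma clipAct_self (x : Fin (l depth) → ℝ) (j : Fin (l depth)) :
    clipAct depth l u v depth x j = clip u v (x j) :=
  if_pos rfl

lemma abs_clipAct_sub_clipAct_le (i : ℕ) (x y : Fin (l i) → ℝ) (j : Fin (l i)) :
    |clipAct depth l u v i x j - clipAct depth l u v i y j| ≤ |x j - y j| := by
  unfold clipAct
  split_ifs
  exacts [abs_clip_sub_clip_le .., abs_rect_sub_rect_le ..]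

lemma continuous_clipAct (i : ℕ) : Continuous (clipAct depth l u v i) := by
  refine continuous_pi fun j => ?_
  unfold clipAct clip rect
  split_ifs <;> fun_prop

lemma realNN_mem_Icc (h0 : l 0 = d) (h1 : l depth = 1) (hdepth : 1 ≤ depth) (huv : u ≤ v)
    (θ : Fin D → ℝ) (x : Fin d → ℝ) : realNN h0 h1 u v θ x ∈ Set.Icc u v := by
  obtain ⟨k, rfl⟩ : ∃ k, depth = k + 1 := ⟨depth - 1, by omega⟩
  rw [realNN, clippedNN_eq_network, network, clipAct_self]
  exact clip_mem_Icc huv _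

lemma abs_realNN_sub_realNN_le (h0 : l 0 = d) (h1 : l depth = 1) {β c δ : ℝ} {x : Fin d → ℝ}
    (hβ : 1 ≤ β) (hc : 1 ≤ c) (hδ : 0 ≤ δ) (hθ : ∀ t < numParams l depth, |param θ t| ≤ β)
    (hϑ : ∀ t < numParams l depth, |param ϑ t| ≤ β)
    (hθϑ : ∀ t < numParams l depth, |param θ t - param ϑ t| ≤ δ) (hx : ∀ i, |x i| ≤ c) :
    |realNN h0 h1 u v θ x - realNN h0 h1 u v ϑ x|
      ≤ depth * c * ((maxWidth depth l : ℝ) + 1) ^ depth * β ^ (depth - 1) * δ := by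
  rw [← zero_add (numParams l depth)] at hθ hϑ hθϑ
  exact abs_network_sub_network_le
    (fun n hn y j => (congrArg _ (clipAct_of_lt hn y j)).trans_le (abs_rect_le _))
    (fun n _ => abs_clipAct_sub_clipAct_le n) (fun n hn => le_maxWidth l hn.le) hβ hc hδ hθ hϑ
    hθϑ (fun _ => hx _) _

lemma continuous_realNN (h0 : l 0 = d) (h1 : l depth = 1) :
    Continuous fun q : (Fin D → ℝ) × (Fin d → ℝ) => realNN h0 h1 u v q.1 q.2 := by
  have hcast : Continuous fun q : (Fin D → ℝ) × (Fin d → ℝ) =>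
      (q.1, fun i : Fin (l 0) => q.2 (Fin.cast h0 i)) := by fun_prop
  exact (continuous_apply (Fin.cast h1.symm 0)).comp
    ((continuous_network continuous_clipAct 0 depth).comp hcast)

end ClippedNetwork

section StoredLayers

/-- The infinite parameter sequence that stores the weight matrices `W k` and the bias vectors
`β k` of the first `n` affine maps in the order in which `network` reads them; it continues by
zeros. -/
def storedParams (l : ℕ → ℕ) (W : ℕ → ℕ → ℕ → ℝ) (β : ℕ → ℕ → ℝ) : ℕ → ℕ → ℝ
  | 0, _ => 0
  | n + 1, t =>
      if t < numParams l n then storedParams l W β n t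
      else if t - numParams l n < l (n + 1) * l n then
        W n ((t - numParams l n) / l n) ((t - numParams l n) % l n)
      else if t < numParams l (n + 1) then β n (t - numParams l n - l (n + 1) * l n)
      else 0

variable {D d k n i j : ℕ} {l : ℕ → ℕ} {W : ℕ → ℕ → ℕ → ℝ} {β : ℕ → ℕ → ℝ}

lemma abs_storedParams_le {c : ℝ} (hc : 0 ≤ c) (hW : ∀ k i j, |W k i j| ≤ c)
    (hβ : ∀ k i, |β k i| ≤ c) (n t : ℕ) : |storedParams l W β n t| ≤ c := by
  have h0 : |(0 : ℝ)| ≤ c := by simpa using hc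
  induction n with
  | zero => exact h0
  | succ n ih =>
    rw [storedParams]
    split_ifs
    exacts [ih, hW _ _ _, hβ _ _, h0]

lemma storedParams_eq_of_lt {t : ℕ} (hkn : k ≤ n) (ht : t < numParams l k) :
    storedParams l W β n t = storedParams l W β k t := by
  induction n, hkn using Nat.le_induction with
  | base => rfl
  | succ n hkn ih => rw [storedParams, if_pos (ht.trans_le (numParams_mono l hkn)), ih]

lemma storedParams_weight (hkn : k < n) (hi : i < l (k + 1)) (hj : j < l k) :
    storedParams l W β n (numParams l k + i * l k + j) = W k i j := by
  have hij : i * l k + j < l (k + 1) * l k := row_major_lt hi hj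
  rw [storedParams_eq_of_lt hkn (by rw [numParams_succ]; linarith), storedParams, add_assoc,
    if_neg (by omega), Nat.add_sub_cancel_left, if_pos hij, mul_comm i,
    Nat.mul_add_div (by omega), Nat.div_eq_of_lt hj, Nat.mul_add_mod, Nat.mod_eq_of_lt hj, add_zero]

lemma storedParams_bias (hkn : k < n) (hi : i < l (k + 1)) :
    storedParams l W β n (numParams l k + l (k + 1) * l k + i) = β k i := by
  have hlt : numParams l k + l (k + 1) * l k + i < numParams l (k + 1) := by
    rw [numParams_succ]
    linarith
  rw [storedParams_eq_of_lt hkn hlt, storedParams, if_neg (by omega), if_neg (by omega),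
    if_pos hlt]
  congr 1
  omega

lemma affine_storedParams (hkn : k < n) (hD : numParams l n ≤ D) (y : ℕ → ℝ)
    (i : Fin (l (k + 1))) :
    affine (l (k + 1)) (l k) (fun t : Fin D => storedParams l W β n t) (0 + numParams l k)
      (fun j => y j) i = ∑ j ∈ Finset.range (l k), W k i j * y j + β k i := by
  have hparam {t : ℕ} (ht : t < numParams l k + l (k + 1) * (l k + 1)) :
      param (fun t : Fin D => storedParams l W β n t) t = storedParams l W β n t := by
    rw [← numParams_succ] at ht
    exact dif_pos (ht.trans_le ((numParams_mono l hkn).trans hD))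
  rw [affine, zero_add, Finset.sum_range, hparam (bias_index_lt _ _ i), storedParams_bias hkn i.2]
  congr 1
  refine Finset.sum_congr rfl fun j _ => ?_
  rw [hparam (weight_index_lt _ i j), storedParams_weight hkn i.2 j.2]

lemma realNN_storedParams (h0 : l 0 = d) (h1 : l (k + 1) = 1) (u v : ℝ)
    (hD : numParams l (k + 1) ≤ D) {x : Fin d → ℝ} {h : ℕ → ℕ → ℝ}
    (hx : ∀ i < d, h 0 i = param x i)
    (hh : ∀ n < k, ∀ i < l (n + 1),
      h (n + 1) i = rect (∑ j ∈ Finset.range (l n), W n i j * h n j + β n i)) :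
    realNN h0 h1 u v (fun t : Fin D => storedParams l W β (k + 1) t) x =
      clip u v (∑ j ∈ Finset.range (l k), W k 0 j * h k j + β k 0) := by
  have hstate : ∀ n ≤ k, network l (clipAct (k + 1) l u v)
      (fun t : Fin D => storedParams l W β (k + 1) t) 0 n (fun i => x (Fin.cast h0 i)) =
        fun i : Fin (l n) => h n i := by
    intro n hn
    induction n with
    | zero =>
      funext i
      have hi : (i : ℕ) < d := h0 ▸ i.2
      rw [hx _ hi, param, dif_pos hi]
      rfl
    | succ n ih =>
      funext i
      rw [network, clipAct_of_lt (by omega), ih (by omega),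
        affine_storedParams (by omega) hD, hh n hn i i.2]
  rw [realNN, clippedNN_eq_network, network, clipAct_self, hstate k le_rfl,
    affine_storedParams k.lt_succ_self hD]
  rfl

end StoredLayers

section ConeNetwork

lemma rect_add_rect_neg (x : ℝ) : rect x + rect (-x) = |x| := by
  unfold rect
  rcases le_total 0 x with h | h
  · rw [max_eq_left h, max_eq_right (by linarith), abs_of_nonneg h, add_zero]
  · rw [max_eq_right h, max_eq_left (by linarith), abs_of_nonpos h, zero_add]

lemma sum_range_two_mul {M : Type*} [AddCommMonoid M] (f : ℕ → M) (n : ℕ) :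
    ∑ j ∈ Finset.range (2 * n), f j = ∑ i ∈ Finset.range n, (f (2 * i) + f (2 * i + 1)) := by
  induction n with
  | zero => simp
  | succ n ih => rw [Nat.mul_succ, Finset.sum_range_succ, Finset.sum_range_succ,
      Finset.sum_range_succ, ih, add_assoc]

lemma sum_range_ite_eq_mul {R : Type*} [Semiring R] {n : ℕ} {f : ℕ → R}
    (hf : ∀ j, n ≤ j → f j = 0) (t : ℕ) :
    ∑ j ∈ Finset.range n, (if j = t then 1 else 0) * f j = f t := by
  simp only [ite_mul, one_mul, zero_mul, Finset.sum_ite_eq', Finset.mem_range]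
  split_ifs with ht
  exacts [rfl, (hf t (by omega)).symm]

/-- The positive parts of the cones `y ↦ g q - L ‖y - p q‖₁`, `q < N`, continued by zeros. -/
def coneValue (N d : ℕ) (L : ℝ) (p : ℕ → ℕ → ℝ) (g : ℕ → ℝ) (y : ℕ → ℝ) (q : ℕ) : ℝ :=
  if q < N then rect (g q - L * ∑ i ∈ Finset.range d, |y i - p q i|) else 0

/-- The values of the hidden layers of the network that computes the maximum of the cones
`coneValue` at the input `y`. Neurons `2 d q + 2 i` and `2 d q + 2 i + 1` of the first hidden layer
hold the positive and negative parts of `y i - p q i`; the first two neurons of hidden layer `k + 2`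
add up to the maximum of the first `k + 1` cone values, and the remaining ones pass on the cone
values that are still to be compared. -/
def coneState (N d : ℕ) (L : ℝ) (p : ℕ → ℕ → ℝ) (g : ℕ → ℝ) (y : ℕ → ℝ) : ℕ → ℕ → ℝ
  | 0, i => y i
  | 1, t => rect ((-1) ^ t * (y (t % (2 * d) / 2) - p (t / (2 * d)) (t % (2 * d) / 2)))
  | k + 2, 0 => partialSups (coneValue N d L p g y) k - coneValue N d L p g y k
  | k + 2, i + 1 => coneValue N d L p g y (k + i)

/-- The weight matrices of the network with hidden layers `coneState`. -/
def coneWeight (N d : ℕ) (L : ℝ) : ℕ → ℕ → ℕ → ℝ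
  | 0, t, j => (-1) ^ t * if j = t % (2 * d) / 2 then 1 else 0
  | 1, 0, _ => 0
  | 1, q + 1, j => if q < N ∧ j / (2 * d) = q then -L else 0
  | _ + 2, 0, j => (if j = 0 then 1 else 0) + (if j = 1 then 1 else 0) - if j = 2 then 1 else 0
  | _ + 2, i + 1, j => if j = i + 2 then 1 else 0

/-- The bias vectors of the network with hidden layers `coneState`, whose output layer `depth` adds
`u` to the maximum of the cones. -/
def coneBias (N d depth : ℕ) (u : ℝ) (p : ℕ → ℕ → ℝ) (g : ℕ → ℝ) : ℕ → ℕ → ℝ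
  | 0, t => -((-1) ^ t * p (t / (2 * d)) (t % (2 * d) / 2))
  | 1, 0 => 0
  | 1, q + 1 => if q < N then g q else 0
  | k + 2, _ => if k + 3 = depth then u else 0

variable {N d n : ℕ} {L : ℝ} {p : ℕ → ℕ → ℝ} {g y : ℕ → ℝ}

lemma coneValue_nonneg (q : ℕ) : 0 ≤ coneValue N d L p g y q := by
  unfold coneValue
  split_ifs
  exacts [rect_nonneg _, le_rfl]

lemma coneValue_of_le {q : ℕ} (hq : N ≤ q) : coneValue N d L p g y q = 0 :=
  if_neg hq.not_gt

lemma abs_coneWeight_le {c : ℝ} (hL : 0 ≤ L) (hLc : L ≤ c) (hc : 1 ≤ c) (k i j : ℕ) :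
    |coneWeight N d L k i j| ≤ c := by
  have hc0 : 0 ≤ c := zero_le_one.trans hc
  rcases k with _ | _ | k <;> rcases i with _ | i <;> simp only [coneWeight]
  case succ.zero.zero => simpa using hc0
  case succ.zero.succ =>
    split_ifs
    · rwa [abs_neg, abs_of_nonneg hL]
    · simpa using hc0
  all_goals split_ifs <;> first | omega | (norm_num [abs_mul]; try linarith)

lemma abs_coneBias_le {depth : ℕ} {u c : ℝ} (hu : |u| ≤ c) (hp : ∀ q i, |p q i| ≤ c)
    (hg : ∀ q, |g q| ≤ c) (k i : ℕ) : |coneBias N d depth u p g k i| ≤ c := by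
  have hc : |(0 : ℝ)| ≤ c := abs_zero.trans_le ((abs_nonneg u).trans hu)
  rcases k with _ | _ | k <;> rcases i with _ | i <;> simp only [coneBias]
  case succ.zero.zero => exact hc
  case succ.zero.succ => split_ifs; exacts [hg _, hc]
  case succ.succ.zero | succ.succ.succ => split_ifs; exacts [hu, hc]
  all_goals simpa [abs_mul] using hp _ _

/-- Only the `2 d` neurons that belong to the centre `p q` contribute to the `q`-th cone. -/
lemma sum_coneWeight_cone (hd : 1 ≤ d) (hn : 2 * (N * d) ≤ n) {q : ℕ} (hq : q < N) :
    ∑ j ∈ Finset.range n, coneWeight N d L 1 (q + 1) j * coneState N d L p g y 1 j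
      = -L * ∑ i ∈ Finset.range d, |y i - p q i| := by
  have hdq : 2 * d * q + 2 * d ≤ n := by nlinarith
  obtain ⟨r, rfl⟩ := Nat.exists_eq_add_of_le hdq
  have hd2 : 0 < 2 * d := by omega
  have hbefore : ∑ j ∈ Finset.range (2 * d * q),
      coneWeight N d L 1 (q + 1) j * coneState N d L p g y 1 j = 0 :=
    Finset.sum_eq_zero fun j hj => by
      rw [coneWeight, if_neg fun h => (Nat.div_lt_of_lt_mul (Finset.mem_range.1 hj)).ne h.2,
        zero_mul]
  have hafter : ∑ j ∈ Finset.range r, coneWeight N d L 1 (q + 1) (2 * d * q + 2 * d + j) *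
      coneState N d L p g y 1 (2 * d * q + 2 * d + j) = 0 :=
    Finset.sum_eq_zero fun j _ => by
      have hj : q + 1 ≤ (2 * d * q + 2 * d + j) / (2 * d) :=
        (Nat.le_div_iff_mul_le hd2).2 (by nlinarith)
      rw [coneWeight, if_neg fun h => by omega, zero_mul]
  have hblock {s : ℕ} (hs : s < 2 * d) :
      coneWeight N d L 1 (q + 1) (2 * d * q + s) * coneState N d L p g y 1 (2 * d * q + s)
        = -L * rect ((-1) ^ s * (y (s / 2) - p q (s / 2))) := by
    have hdiv : (2 * d * q + s) / (2 * d) = q := by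
      rw [Nat.mul_add_div hd2, Nat.div_eq_of_lt hs, add_zero]
    have hmod : (2 * d * q + s) % (2 * d) = s := by rw [Nat.mul_add_mod, Nat.mod_eq_of_lt hs]
    rw [coneWeight, coneState, hdiv, hmod, if_pos ⟨hq, rfl⟩, mul_assoc 2, pow_add, pow_mul,
      neg_one_sq, one_pow, one_mul]
  rw [Finset.sum_range_add, Finset.sum_range_add, hbefore, hafter, zero_add, add_zero,
    sum_range_two_mul, Finset.mul_sum]
  refine Finset.sum_congr rfl fun i hi => ?_
  have hi' : i < d := Finset.mem_range.1 hi
  rw [hblock (by omega), hblock (by omega), ← mul_add, ← rect_add_rect_neg, pow_succ, pow_mul,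
    neg_one_sq, one_pow, one_mul, one_mul, show 2 * i / 2 = i by omega,
    show (2 * i + 1) / 2 = i by omega, neg_one_mul]

lemma coneState_eq_zero {k j : ℕ} (hn1 : 1 ≤ n) (hn : N + 1 ≤ n + k) (hj : n ≤ j) :
    coneState N d L p g y (k + 2) j = 0 := by
  obtain ⟨i, rfl⟩ : ∃ i, j = i + 1 := ⟨j - 1, by omega⟩
  exact coneValue_of_le (by omega)

lemma sum_coneWeight_max {k : ℕ} (hn1 : 1 ≤ n) (hn : N + 1 ≤ n + k) (k' : ℕ) :
    ∑ j ∈ Finset.range n, coneWeight N d L (k' + 2) 0 j * coneState N d L p g y (k + 2) j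
      = partialSups (coneValue N d L p g y) k - coneValue N d L p g y (k + 1) := by
  have hvanish := fun j => coneState_eq_zero (d := d) (L := L) (p := p) (g := g) (y := y) (j := j)
    hn1 hn
  simp only [coneWeight, add_mul, sub_mul, Finset.sum_add_distrib, Finset.sum_sub_distrib]
  rw [sum_range_ite_eq_mul hvanish, sum_range_ite_eq_mul hvanish, sum_range_ite_eq_mul hvanish]
  simp only [coneState, add_zero, sub_add_cancel]

lemma sum_coneWeight_shift {k : ℕ} (hn1 : 1 ≤ n) (hn : N + 1 ≤ n + k) (k' i : ℕ) :
    ∑ j ∈ Finset.range n, coneWeight N d L (k' + 2) (i + 1) j * coneState N d L p g y (k + 2) j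
      = coneValue N d L p g y (k + 1 + i) := by
  simp only [coneWeight]
  rw [sum_range_ite_eq_mul fun j => coneState_eq_zero hn1 hn, coneState]
  congr 1
  omega

lemma coneState_one {depth : ℕ} {u : ℝ} (hd : 1 ≤ d) (t : ℕ) :
    coneState N d L p g y 1 t = rect (∑ j ∈ Finset.range d,
      coneWeight N d L 0 t j * coneState N d L p g y 0 j + coneBias N d depth u p g 0 t) := by
  have ht : t % (2 * d) / 2 ∈ Finset.range d := by
    have : t % (2 * d) < 2 * d := Nat.mod_lt _ (by omega)
    exact Finset.mem_range.2 (by omega)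
  simp only [coneState, coneWeight, coneBias, mul_assoc, ite_mul, one_mul, zero_mul,
    ← Finset.mul_sum, Finset.sum_ite_eq', if_pos ht, sub_eq_add_neg, mul_add, mul_neg]

lemma coneState_two {depth : ℕ} {u : ℝ} (hd : 1 ≤ d) (hn : 2 * (N * d) ≤ n) (i : ℕ) :
    coneState N d L p g y 2 i = rect (∑ j ∈ Finset.range n,
      coneWeight N d L 1 i j * coneState N d L p g y 1 j + coneBias N d depth u p g 1 i) := by
  rcases i with _ | q
  · simp [coneState, coneWeight, coneBias, rect]
  · rw [coneState, zero_add, coneValue, coneBias]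
    split_ifs with hq
    · rw [sum_coneWeight_cone hd hn hq, neg_mul, neg_add_eq_sub]
    · simp [coneWeight, hq, rect]

/-- Each further layer uses `max a b = (a - b)⁺ + b` for `b ≥ 0`. -/
lemma coneState_add_three {k depth : ℕ} {u : ℝ} (hk : k + 3 < depth) (hn1 : 1 ≤ n)
    (hn : N + 1 ≤ n + k) (i : ℕ) :
    coneState N d L p g y (k + 3) i = rect (∑ j ∈ Finset.range n,
      coneWeight N d L (k + 2) i j * coneState N d L p g y (k + 2) j +
        coneBias N d depth u p g (k + 2) i) := by
  rw [coneBias, if_neg hk.ne, add_zero]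
  rcases i with _ | i
  · rw [sum_coneWeight_max hn1 hn, coneState, partialSups_add_one, rect, ← max_sub_sub_right,
      sub_self]
  · rw [sum_coneWeight_shift hn1 hn, rect_of_nonneg (coneValue_nonneg _), coneState]

lemma realNN_cone {D r : ℕ} {l : ℕ → ℕ} (h0 : l 0 = d) (h1 : l (r + 3) = 1) (u v : ℝ) (hd : 1 ≤ d)
    (hD : numParams l (r + 3) ≤ D) (hr : N ≤ r + 1) (hl1 : 2 * (N * d) ≤ l 1)
    (hl : ∀ k ≤ r, 1 ≤ l (k + 2) ∧ N + 1 ≤ l (k + 2) + k) (x : Fin d → ℝ) :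
    realNN h0 h1 u v (fun t : Fin D =>
        storedParams l (coneWeight N d L) (coneBias N d (r + 3) u p g) (r + 3) t) x
      = clip u v (partialSups (coneValue N d L p g (param x)) r + u) := by
  rw [realNN_storedParams h0 h1 u v hD (h := coneState N d L p g (param x)) fun _ _ => rfl,
    sum_coneWeight_max (hl r le_rfl).1 (hl r le_rfl).2, coneValue_of_le hr, sub_zero, coneBias,
    if_pos rfl]
  rintro (_ | _ | k) hk i -
  · rw [h0]
    exact coneState_one hd i
  · exact coneState_two hd hl1 i
  · exact coneState_add_three (by omega) (hl k (by omega)).1 (hl k (by omega)).2 i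

end ConeNetwork

section Approximation

lemma exists_midpoint_near {a b y : ℝ} (hab : a < b) (hy : y ∈ Set.Icc a b) {n : ℕ} (hn : 1 ≤ n) :
    ∃ t : Fin n, |y - (a + (b - a) * (2 * t + 1) / (2 * n))| ≤ (b - a) / (2 * n) := by
  have hn0 : (0 : ℝ) < n := by exact_mod_cast hn
  have hba : 0 < b - a := sub_pos.2 hab
  obtain ⟨s, hs, rfl⟩ : ∃ s ∈ Set.Icc (0 : ℝ) n, y = a + (b - a) * s / n := by
    refine ⟨n * ((y - a) / (b - a)), ⟨?_, ?_⟩, by field_simp; ring⟩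
    · exact mul_nonneg hn0.le (div_nonneg (sub_nonneg.2 hy.1) hba.le)
    · exact mul_le_of_le_one_right hn0.le ((div_le_one hba).2 (sub_le_sub_right hy.2 a))
  obtain ⟨t, ht1, ht2⟩ : ∃ t : Fin n, (t : ℝ) ≤ s ∧ s ≤ t + 1 := by
    by_cases h : ⌊s⌋₊ < n
    · exact ⟨⟨_, h⟩, Nat.floor_le hs.1, (Nat.lt_floor_add_one s).le⟩
    · have h' : (n : ℝ) ≤ s := (Nat.le_floor_iff hs.1).1 (not_lt.1 h)
      refine ⟨⟨n - 1, by omega⟩, ?_, ?_⟩ <;> push_cast [Nat.cast_sub hn] <;> linarith [hs.2]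
  refine ⟨t, ?_⟩
  have hdist : a + (b - a) * s / n - (a + (b - a) * (2 * t + 1) / (2 * n))
      = (b - a) / (2 * n) * (2 * s - 2 * t - 1) := by
    field_simp
    ring
  rw [hdist, abs_mul, abs_of_nonneg (by positivity)]
  exact mul_le_of_le_one_right (by positivity) (abs_le.2 ⟨by linarith, by linarith⟩)

lemma midpoint_mem_Icc {a b : ℝ} (hab : a ≤ b) {n : ℕ} (t : Fin n) :
    a + (b - a) * (2 * t + 1) / (2 * n) ∈ Set.Icc a b := by
  have ht : (t : ℝ) + 1 ≤ n := by exact_mod_cast t.2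
  have hn : (0 : ℝ) < n := by positivity [t.pos]
  have hba : 0 ≤ b - a := sub_nonneg.2 hab
  refine ⟨le_add_of_nonneg_right (by positivity), ?_⟩
  rw [← le_sub_iff_add_le', div_le_iff₀ (by positivity)]
  exact mul_le_mul_of_nonneg_left (by linarith) hba

lemma exists_cube_grid (d : ℕ) {a b : ℝ} (hab : a < b) {n : ℕ} (hn : 1 ≤ n) :
    ∃ p : ℕ → cube d a b, ∀ x : cube d a b, ∃ q < n ^ d,
      ∑ i, |(x : Fin d → ℝ) i - (p q : Fin d → ℝ) i| ≤ d * ((b - a) / (2 * n)) := by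
  let grid (t : Fin d → Fin n) : cube d a b :=
    ⟨fun i => a + (b - a) * (2 * t i + 1) / (2 * n), fun i => (midpoint_mem_Icc hab.le (t i)).1,
      fun i => (midpoint_mem_Icc hab.le (t i)).2⟩
  refine ⟨fun q => if hq : q < n ^ d then grid (finFunctionFinEquiv.symm ⟨q, hq⟩)
    else grid fun _ => ⟨0, hn⟩, fun x => ?_⟩
  choose t ht using fun i => exists_midpoint_near hab ⟨x.2.1 i, x.2.2 i⟩ hn
  refine ⟨finFunctionFinEquiv t, (finFunctionFinEquiv t).2, ?_⟩
  simp only [dif_pos (finFunctionFinEquiv t).2, Fin.eta, Equiv.symm_apply_apply]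
  exact (Finset.sum_le_card_nsmul _ _ _ fun i _ => ht i).trans (by simp)

lemma abs_le_of_mem_cube {d : ℕ} {a b c : ℝ} (ha : |a| ≤ c) (hb : |b| ≤ c) (x : cube d a b)
    (i : Fin d) : |(x : Fin d → ℝ) i| ≤ c :=
  abs_le.2 ⟨(neg_le_of_abs_le ha).trans (x.2.1 i), (x.2.2 i).trans ((le_abs_self b).trans hb)⟩

lemma sum_abs_param_sub_param {d : ℕ} (x y : Fin d → ℝ) :
    ∑ i ∈ Finset.range d, |param x i - param y i| = ∑ i, |x i - y i| := by
  simp [Finset.sum_range, param]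

lemma lipschitz_const_nonneg {d : ℕ} (hd : 1 ≤ d) {a b u v L : ℝ} (hab : a < b)
    {E : cube d a b → Set.Icc u v} (hLip : ∀ x y : cube d a b,
      |(E x : ℝ) - (E y : ℝ)| ≤ L * ∑ i : Fin d, |(x : Fin d → ℝ) i - (y : Fin d → ℝ) i|) :
    0 ≤ L := by
  have hd0 : (0 : ℝ) < d := by exact_mod_cast hd
  have hab' : 0 < |b - a| := abs_pos.2 (sub_pos.2 hab).ne'
  have h := (abs_nonneg _).trans (hLip ⟨fun _ => b, fun _ => hab.le, fun _ => le_rfl⟩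
    ⟨fun _ => a, fun _ => le_rfl, fun _ => hab.le⟩)
  simp only [Finset.sum_const, Finset.card_univ, Fintype.card_fin, nsmul_eq_mul] at h
  exact nonneg_of_mul_nonneg_left h (mul_pos hd0 hab')

lemma abs_clip_sub_le {u v : ℝ} (y : ℝ) (e : Set.Icc u v) : |clip u v y - e| ≤ |y - e| := by
  simpa only [clip_of_mem_Icc e.2] using abs_clip_sub_clip_le u v y e

lemma exists_params_const {D d depth : ℕ} {l : ℕ → ℕ} (h0 : l 0 = d) (h1 : l depth = 1)
    (hdepth : 1 ≤ depth) (hD : numParams l depth ≤ D) (u v : ℝ) {c e : ℝ} (he : |e| ≤ c) :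
    ∃ θ : Fin D → ℝ, (∀ i, |θ i| ≤ c) ∧ ∀ x : Fin d → ℝ, realNN h0 h1 u v θ x = clip u v e := by
  obtain ⟨k, rfl⟩ : ∃ k, depth = k + 1 := ⟨depth - 1, by omega⟩
  have hc : |(0 : ℝ)| ≤ c := abs_zero.trans_le ((abs_nonneg e).trans he)
  refine ⟨fun t => storedParams l (fun _ _ _ => 0) (fun _ _ => e) (k + 1) t,
    fun t => abs_storedParams_le ((abs_nonneg e).trans he) (fun _ _ _ => hc) (fun _ _ => he) _ _,
    fun x => ?_⟩
  rw [realNN_storedParams h0 h1 u v hD (h := fun n i => if n = 0 then param x i else rect e)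
    (fun _ _ => rfl) (by simp)]
  simp

lemma exists_params_approx_of_net {D d N r : ℕ} {l : ℕ → ℕ} (h0 : l 0 = d) (h1 : l (r + 3) = 1)
    (hd : 1 ≤ d) (hD : numParams l (r + 3) ≤ D) (hr : N ≤ r + 1) (hl1 : 2 * (N * d) ≤ l 1)
    (hl : ∀ k ≤ r, 1 ≤ l (k + 2) ∧ N + 1 ≤ l (k + 2) + k) {a b u v c L δ : ℝ} (hc1 : 1 ≤ c)
    (ha : |a| ≤ c) (hb : |b| ≤ c) (hu : |u| ≤ c) (huv : v - u ≤ c) (hL : 0 ≤ L) (hLc : L ≤ c)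
    {E : cube d a b → Set.Icc u v} (hLip : ∀ x y : cube d a b,
      |(E x : ℝ) - (E y : ℝ)| ≤ L * ∑ i : Fin d, |(x : Fin d → ℝ) i - (y : Fin d → ℝ) i|)
    {p : ℕ → cube d a b} (hp : ∀ x : cube d a b, ∃ q < N,
      ∑ i : Fin d, |(x : Fin d → ℝ) i - (p q : Fin d → ℝ) i| ≤ δ) :
    ∃ θ : Fin D → ℝ, (∀ i, |θ i| ≤ c) ∧ ∀ x : cube d a b,
      |realNN h0 h1 u v θ x - (E x : ℝ)| ≤ 2 * L * δ := by
  have hc0 : 0 ≤ c := zero_le_one.trans hc1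
  have hheight (x : cube d a b) : |(E x : ℝ) - u| ≤ c := by
    rw [abs_of_nonneg (sub_nonneg.2 (E x).2.1)]
    exact (sub_le_sub_right (E x).2.2 u).trans huv
  let P (q i : ℕ) : ℝ := param (p q : Fin d → ℝ) i
  let g (q : ℕ) : ℝ := E (p q) - u
  refine ⟨fun t => storedParams l (coneWeight N d L) (coneBias N d (r + 3) u P g) (r + 3) t,
    fun t => abs_storedParams_le hc0 (abs_coneWeight_le hL hLc hc1)
      (abs_coneBias_le hu (fun q => abs_param_le hc0 (abs_le_of_mem_cube ha hb (p q)))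
        fun q => hheight (p q)) _ _, fun x => ?_⟩
  rw [realNN_cone h0 h1 u v hd hD hr hl1 hl]
  refine (abs_clip_sub_le _ _).trans (abs_le.2 ?_)
  have hupper : partialSups (coneValue N d L P g (param (x : Fin d → ℝ))) r ≤ E x - u := by
    refine partialSups_le _ _ _ fun q _ => ?_
    unfold coneValue
    split_ifs
    · refine max_le ?_ (sub_nonneg.2 (E x).2.1)
      rw [sum_abs_param_sub_param]
      linarith [neg_le_of_abs_le (hLip x (p q))]
    · exact sub_nonneg.2 (E x).2.1
  obtain ⟨q, hq, hδ⟩ := hp x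
  have hlower : E x - u - 2 * L * δ ≤
      partialSups (coneValue N d L P g (param (x : Fin d → ℝ))) r := by
    refine le_trans ?_ (le_partialSups_of_le _ (show q ≤ r by omega))
    rw [coneValue, if_pos hq]
    refine le_max_of_le_left ?_
    rw [sum_abs_param_sub_param]
    linarith [le_of_abs_le (hLip x (p q)), mul_le_mul_of_nonneg_left hδ hL]
  constructor <;> linarith

lemma two_mul_le_two_pow {d : ℕ} (hd : 1 ≤ d) : 2 * d ≤ 2 ^ d := by
  induction d, hd using Nat.le_induction with
  | base => simp
  | succ d hd ih => rw [pow_succ]; omega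

lemma exists_grid_size {A : ℝ} {d : ℕ} (hd : 1 ≤ d) (hA : (6 : ℝ) ^ d < A) :
    ∃ n : ℕ, 1 ≤ n ∧ A ^ ((1 : ℝ) / d) / 3 ≤ n ∧ 2 * d * (n : ℝ) ^ d < A := by
  have hd0 : d ≠ 0 := by omega
  have hA0 : 0 < A := (by positivity : (0 : ℝ) < 6 ^ d).trans hA
  obtain ⟨r, hr0, rfl⟩ : ∃ r : ℝ, 0 ≤ r ∧ r ^ d = A :=
    ⟨A ^ (d : ℝ)⁻¹, Real.rpow_nonneg hA0.le _, Real.rpow_inv_natCast_pow hA0.le hd0⟩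
  have hr6 : 6 < r := lt_of_pow_lt_pow_left₀ d hr0 hA
  have hceil : (⌈r / 3⌉₊ : ℝ) < r / 2 := by
    linarith [Nat.ceil_lt_add_one (show 0 ≤ r / 3 by linarith)]
  have h2 : (2 : ℝ) * d ≤ 2 ^ d := by exact_mod_cast two_mul_le_two_pow hd
  refine ⟨⌈r / 3⌉₊, Nat.one_le_ceil_iff.2 (by linarith), ?_, ?_⟩
  · rw [one_div, Real.pow_rpow_inv_natCast hr0 hd0]
    exact Nat.le_ceil _
  · calc 2 * d * (⌈r / 3⌉₊ : ℝ) ^ d ≤ 2 ^ d * (⌈r / 3⌉₊ : ℝ) ^ d := by gcongr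
      _ < 2 ^ d * (r / 2) ^ d := by gcongr
      _ = r ^ d := by rw [← mul_pow, mul_div_cancel₀ _ two_ne_zero]

variable {D d depth : ℕ} {l : ℕ → ℕ} {A L a b u v c : ℝ} {E : cube d a b → Set.Icc u v}

lemma exists_params_approx_of_lt (h0 : l 0 = d) (h1 : l depth = 1) (hd : 1 ≤ d)
    (hD : numParams l depth ≤ D) (hA : (6 : ℝ) ^ d < A) (hab : a < b) (hc1 : 1 ≤ c)
    (hLc : L ≤ c) (ha : |a| ≤ c) (hb : |b| ≤ c) (hu : |u| ≤ c) (huv : v - u ≤ c)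
    (hdepth : A / (2 * d) + 1 ≤ depth) (hl1 : A ≤ l 1)
    (hli : ∀ i : ℕ, 2 ≤ i → i < depth → max (A / d - 2 * i + 3) 2 ≤ (l i : ℝ))
    (hLip : ∀ x y : cube d a b,
      |(E x : ℝ) - (E y : ℝ)| ≤ L * ∑ i : Fin d, |(x : Fin d → ℝ) i - (y : Fin d → ℝ) i|) :
    ∃ θ : Fin D → ℝ, (∀ i, |θ i| ≤ c) ∧ ∀ x : cube d a b,
      |realNN h0 h1 u v θ x - (E x : ℝ)| ≤ 3 * d * L * (b - a) / A ^ ((1 : ℝ) / d) := by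
  have hL := lipschitz_const_nonneg hd hab hLip
  have hd0 : (0 : ℝ) < d := by exact_mod_cast hd
  obtain ⟨n, hn, hrn, hnA⟩ := exists_grid_size hd hA
  obtain ⟨p, hp⟩ := exists_cube_grid d hab hn
  have hNA : 2 * ((n ^ d : ℕ) : ℝ) < A / d := by
    rw [lt_div_iff₀ hd0]
    push_cast
    linarith
  have hN : 1 ≤ n ^ d := Nat.one_le_pow _ _ hn
  have hdepthN : n ^ d + 1 < depth := by
    rw [mul_comm, div_mul_eq_div_div] at hdepth
    exact_mod_cast (show ((n ^ d : ℕ) : ℝ) + 1 < depth by linarith)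
  have hw1 : 2 * (n ^ d * d) ≤ l 1 := by
    exact_mod_cast (show 2 * ((n : ℝ) ^ d * d) ≤ l 1 by linarith)
  obtain ⟨r, rfl⟩ : ∃ r, depth = r + 3 := ⟨depth - 3, by omega⟩
  have hw : ∀ k ≤ r, 1 ≤ l (k + 2) ∧ n ^ d + 1 ≤ l (k + 2) + k := fun k hk => by
    have h := hli (k + 2) (by omega) (by omega)
    have h2 : 2 ≤ l (k + 2) := by exact_mod_cast (le_max_right _ _).trans h
    have h3 : 2 * ((n ^ d : ℕ) : ℝ) < l (k + 2) + 2 * k + 1 := by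
      have := (le_max_left _ _).trans h
      push_cast at this ⊢ hNA
      linarith
    have h4 : 2 * n ^ d < l (k + 2) + 2 * k + 1 := by exact_mod_cast h3
    omega
  obtain ⟨θ, hθ, hθE⟩ := exists_params_approx_of_net h0 h1 hd hD (by omega) hw1 hw hc1 ha hb hu huv
    hL hLc hLip hp
  refine ⟨θ, hθ, fun x => (hθE x).trans ?_⟩
  have hr0 : 0 < A ^ ((1 : ℝ) / d) :=
    Real.rpow_pos_of_pos ((by positivity : (0 : ℝ) < 6 ^ d).trans hA) _
  calc 2 * L * (d * ((b - a) / (2 * n))) = d * L * (b - a) / n := by field_simp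
    _ ≤ d * L * (b - a) / (A ^ ((1 : ℝ) / d) / 3) := by
        have := sub_nonneg.2 hab.le
        gcongr
    _ = 3 * d * L * (b - a) / A ^ ((1 : ℝ) / d) := by field_simp

lemma exists_params_approx_of_le (h0 : l 0 = d) (h1 : l depth = 1) (hd : 1 ≤ d)
    (hdepth : 1 ≤ depth) (hD : numParams l depth ≤ D) (hA0 : 0 < A) (hA : A ≤ 6 ^ d) (hab : a < b)
    (hu : |u| ≤ c) (hv : |v| ≤ c) (hLip : ∀ x y : cube d a b,
      |(E x : ℝ) - (E y : ℝ)| ≤ L * ∑ i : Fin d, |(x : Fin d → ℝ) i - (y : Fin d → ℝ) i|) :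
    ∃ θ : Fin D → ℝ, (∀ i, |θ i| ≤ c) ∧ ∀ x : cube d a b,
      |realNN h0 h1 u v θ x - (E x : ℝ)| ≤ 3 * d * L * (b - a) / A ^ ((1 : ℝ) / d) := by
  have hL := lipschitz_const_nonneg hd hab hLip
  let m : cube d a b := ⟨fun _ => (a + b) / 2, fun _ => by linarith, fun _ => by linarith⟩
  have hm (x : cube d a b) :
      ∑ i, |(m : Fin d → ℝ) i - (x : Fin d → ℝ) i| ≤ d * ((b - a) / 2) := by
    refine (Finset.sum_le_card_nsmul _ _ ((b - a) / 2) fun i _ => ?_).trans (by simp)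
    have hxa : a ≤ (x : Fin d → ℝ) i := x.2.1 i
    have hxb : (x : Fin d → ℝ) i ≤ b := x.2.2 i
    change |(a + b) / 2 - (x : Fin d → ℝ) i| ≤ _
    exact abs_le.2 ⟨by linarith, by linarith⟩
  obtain ⟨θ, hθ, hθx⟩ := exists_params_const (D := D) h0 h1 hdepth hD u v
    (abs_le_max_abs_abs (E m).2.1 (E m).2.2 |>.trans (max_le hu hv))
  have hA6 : A ^ ((1 : ℝ) / d) ≤ 6 := by
    rw [one_div]
    exact (Real.rpow_inv_le_iff_of_pos hA0.le (by norm_num) (by exact_mod_cast hd)).2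
      (by rwa [Real.rpow_natCast])
  refine ⟨θ, hθ, fun x => ?_⟩
  calc |realNN h0 h1 u v θ x - (E x : ℝ)| = |clip u v (E m) - (E x : ℝ)| := by rw [hθx]
    _ ≤ |(E m : ℝ) - E x| := abs_clip_sub_le _ _
    _ ≤ L * (d * ((b - a) / 2)) := (hLip m x).trans (mul_le_mul_of_nonneg_left (hm x) hL)
    _ = 3 * d * L * (b - a) / 6 := by ring
    _ ≤ 3 * d * L * (b - a) / A ^ ((1 : ℝ) / d) := by
        have := sub_nonneg.2 hab.le
        have := Real.rpow_pos_of_pos hA0 ((1 : ℝ) / d)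
        gcongr

theorem exists_params_approx (h0 : l 0 = d) (h1 : l depth = 1) (hd : 1 ≤ d) (hdepth : 1 ≤ depth)
    (hD : numParams l depth ≤ D) (hA : 0 < A) (hab : a < b) (hc1 : 1 ≤ c) (hLc : L ≤ c)
    (ha : |a| ≤ c) (hb : |b| ≤ c) (hu : 2 * |u| ≤ c) (hv : 2 * |v| ≤ c)
    (hdepthA : A * (Set.Ioi ((6 : ℝ) ^ d)).indicator 1 A / (2 * d) + 1 ≤ (depth : ℝ))
    (hl1 : A * (Set.Ioi ((6 : ℝ) ^ d)).indicator 1 A ≤ (l 1 : ℝ))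
    (hli : ∀ i : ℕ, 2 ≤ i → i < depth →
      (Set.Ioi ((6 : ℝ) ^ d)).indicator 1 A * max (A / d - 2 * i + 3) 2 ≤ (l i : ℝ))
    (hLip : ∀ x y : cube d a b,
      |(E x : ℝ) - (E y : ℝ)| ≤ L * ∑ i : Fin d, |(x : Fin d → ℝ) i - (y : Fin d → ℝ) i|) :
    ∃ θ : Fin D → ℝ, (∀ i, |θ i| ≤ c) ∧ ∀ x : cube d a b,
      |realNN h0 h1 u v θ x - (E x : ℝ)| ≤ 3 * d * L * (b - a) / A ^ ((1 : ℝ) / d) := by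
  have hu' : |u| ≤ c := by linarith [abs_nonneg u]
  have hv' : |v| ≤ c := by linarith [abs_nonneg v]
  rcases le_or_gt A (6 ^ d) with hA6 | hA6
  · exact exists_params_approx_of_le h0 h1 hd hdepth hD hA hA6 hab hu' hv' hLip
  · rw [Set.indicator_of_mem (Set.mem_Ioi.2 hA6), Pi.one_apply] at hdepthA hl1 hli
    simp only [mul_one, one_mul] at hdepthA hl1 hli
    exact exists_params_approx_of_lt h0 h1 hd hD hA6 hab hc1 hLc ha hb hu'
      (by linarith [neg_le_abs u, le_abs_self v]) hdepthA hl1 hli hLip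

end Approximation

section Moments

lemma Gamma_add_one_le_one {q : ℝ} (hq : q ∈ Set.Icc 0 1) : Real.Gamma (q + 1) ≤ 1 := by
  have h := Real.convexOn_Gamma.2 (x := 1) (y := 2) (by simp) (by simp) (sub_nonneg.2 hq.2) hq.1
    (sub_add_cancel 1 q)
  simp only [smul_eq_mul, Real.Gamma_one, Real.Gamma_two, mul_one, sub_add_cancel] at h
  rwa [show 1 - q + q * 2 = q + 1 by ring] at h

lemma Gamma_add_one_le_rpow {q : ℝ} (hq : 0 < q) : Real.Gamma (q + 1) ≤ (max 1 q) ^ q := by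
  suffices key : ∀ (n : ℕ) (q : ℝ), 0 < q → q ≤ n + 1 → Real.Gamma (q + 1) ≤ (max 1 q) ^ q from
    key ⌈q⌉₊ q hq ((Nat.le_ceil q).trans (by linarith))
  intro n
  induction n with
  | zero =>
    intro q hq hq1
    rw [Nat.cast_zero, zero_add] at hq1
    rw [max_eq_left hq1, Real.one_rpow]
    exact Gamma_add_one_le_one ⟨hq.le, hq1⟩
  | succ n ih =>
    intro q hq hqn
    rcases le_or_gt q 1 with h1 | h1
    · exact ih q hq (h1.trans (le_add_of_nonneg_left n.cast_nonneg))
    · have hpred := ih (q - 1) (by linarith) (by push_cast at hqn; linarith)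
      rw [sub_add_cancel] at hpred
      rw [Real.Gamma_add_one hq.ne', max_eq_right h1.le]
      calc q * Real.Gamma q ≤ q * (max 1 (q - 1)) ^ (q - 1) := by gcongr
        _ ≤ q * q ^ (q - 1) := by
            gcongr
            exact max_le h1.le (by linarith)
        _ = q ^ q := by
            rw [Real.rpow_sub_one hq.ne']
            field_simp

variable {Ω : Type*} [MeasurableSpace Ω] {μ : Measure Ω}

lemma lintegral_rpow_le_of_tail {f : Ω → ℝ} (hf0 : ∀ ω, 0 ≤ f ω) (hf : Measurable f)
    {C b δ q : ℝ} (hC : 0 ≤ C) (hb : 0 < b) (hδ : 0 < δ) (hq : 0 < q)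
    (htail : ∀ t, 0 < t → μ {ω | t < f ω} ≤ ENNReal.ofReal (C * Real.exp (-b * t ^ δ))) :
    ∫⁻ ω, ENNReal.ofReal (f ω ^ q) ∂μ
      ≤ ENNReal.ofReal (C * b ^ (-q / δ) * Real.Gamma (q / δ + 1)) := by
  rw [lintegral_rpow_eq_lintegral_meas_lt_mul μ (.of_forall hf0) hf.aemeasurable hq]
  have hI := integrableOn_rpow_mul_exp_neg_mul_rpow (s := q - 1) (p := δ) (b := b) (by linarith)
    hδ hb
  have h1 : ∫⁻ t in Set.Ioi (0 : ℝ), μ {ω | t < f ω} * ENNReal.ofReal (t ^ (q - 1))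
      ≤ ∫⁻ t in Set.Ioi (0 : ℝ), ENNReal.ofReal (C * (t ^ (q - 1) * Real.exp (-b * t ^ δ))) := by
    refine setLIntegral_mono' measurableSet_Ioi fun t ht => ?_
    have ht : 0 < t := ht
    refine (mul_le_mul_left (htail t ht) _).trans_eq ?_
    rw [← ENNReal.ofReal_mul (by positivity)]
    congr 1; ring
  refine (mul_le_mul_right h1 _).trans_eq ?_
  rw [← ofReal_integral_eq_lintegral_ofReal (hI.const_mul C), integral_const_mul,
    integral_rpow_mul_exp_neg_mul_rpow hδ (by linarith) hb, ← ENNReal.ofReal_mul hq.le,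
    sub_add_cancel, Real.Gamma_add_one (by positivity)]
  · congr 1; ring
  · filter_upwards [ae_restrict_mem measurableSet_Ioi] with t ht
    have ht : 0 < t := ht
    positivity

lemma eLpNorm_le_of_lintegral_rpow_le {f : Ω → ℝ} (hf0 : ∀ ω, 0 ≤ f ω) {p B : ℝ} (hp : 0 < p)
    (hB : 0 ≤ B) (h : ∫⁻ ω, ENNReal.ofReal (f ω ^ p) ∂μ ≤ ENNReal.ofReal (B ^ p)) :
    eLpNorm f (ENNReal.ofReal p) μ ≤ ENNReal.ofReal B := by
  rw [eLpNorm_eq_lintegral_rpow_enorm_toReal (by simpa using hp) ENNReal.ofReal_ne_top,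
    ENNReal.toReal_ofReal hp.le]
  calc (∫⁻ ω, ‖f ω‖ₑ ^ p ∂μ) ^ (1 / p) = (∫⁻ ω, ENNReal.ofReal (f ω ^ p) ∂μ) ^ (1 / p) := by
        congr 1
        refine lintegral_congr fun ω => ?_
        rw [Real.enorm_of_nonneg (hf0 ω), ENNReal.ofReal_rpow_of_nonneg (hf0 ω) hp.le]
    _ ≤ (ENNReal.ofReal (B ^ p)) ^ (1 / p) := by gcongr
    _ = ENNReal.ofReal B := by
        rw [ENNReal.ofReal_rpow_of_nonneg (by positivity) (by positivity), ← Real.rpow_mul hB,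
          mul_one_div_cancel hp.ne', Real.rpow_one]

lemma measurable_inf' {ι : Type*} [Fintype ι] [Nonempty ι] {f : ι → Ω → ℝ}
    (hf : ∀ k, Measurable (f k)) :
    Measurable fun ω => Finset.univ.inf' Finset.univ_nonempty fun k => f k ω := by
  have h : Measurable (Finset.univ.inf' Finset.univ_nonempty f) :=
    Finset.inf'_induction _ _ (fun _ h₁ _ h₂ => h₁.inf h₂) fun k _ => hf k
  simpa only [← Finset.inf'_apply] using h

lemma measure_lt_inf'_le {ι : Type*} [Fintype ι] [Nonempty ι] {f : ι → Ω → ℝ}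
    (hindep : iIndepFun f μ) {t r : ℝ}
    (h : ∀ k, μ {ω | t < f k ω} ≤ ENNReal.ofReal (Real.exp (-r))) :
    μ {ω | t < Finset.univ.inf' Finset.univ_nonempty fun k => f k ω}
      ≤ ENNReal.ofReal (Real.exp (-(Fintype.card ι * r))) := by
  have hset : {ω | t < Finset.univ.inf' Finset.univ_nonempty fun k => f k ω}
      = ⋂ k ∈ (Finset.univ : Finset ι), f k ⁻¹' Set.Ioi t := by
    ext ω
    simp [Finset.lt_inf'_iff]
  rw [hset, hindep.measure_inter_preimage_eq_mul _ fun k _ => measurableSet_Ioi]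
  refine (Finset.prod_le_prod' fun k _ => h k).trans_eq ?_
  rw [Finset.prod_const, Finset.card_univ, ← ENNReal.ofReal_pow (Real.exp_pos _).le,
    ← Real.exp_nat_mul, mul_neg]

lemma eLpNorm_inf'_le {ι : Type*} [Fintype ι] [Nonempty ι] {f : ι → Ω → ℝ}
    (hf : ∀ k, Measurable (f k)) (hf0 : ∀ k ω, 0 ≤ f k ω) (hindep : iIndepFun f μ) {s δ p : ℝ}
    (hs : 0 < s) (hδ : 1 ≤ δ) (hp : 1 ≤ p)
    (htail : ∀ k t, 0 < t → μ {ω | t < f k ω} ≤ ENNReal.ofReal (Real.exp (-(t / s) ^ δ))) :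
    eLpNorm (fun ω => Finset.univ.inf' Finset.univ_nonempty fun k => f k ω) (ENNReal.ofReal p) μ
      ≤ ENNReal.ofReal (s * p / (Fintype.card ι : ℝ) ^ δ⁻¹) := by
  obtain ⟨K, hK⟩ : ∃ K, K = Fintype.card ι := ⟨_, rfl⟩
  rw [← hK]
  have hK0 : (0 : ℝ) < K := by exact_mod_cast hK ▸ Fintype.card_pos
  have hδ0 : 0 < δ := zero_lt_one.trans_le hδ
  have hp0 : 0 < p := zero_lt_one.trans_le hp
  have hmin0 (ω) : 0 ≤ Finset.univ.inf' Finset.univ_nonempty fun k => f k ω :=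
    (Finset.le_inf'_iff _ _).2 fun k _ => hf0 k ω
  have htail' (t : ℝ) (ht : 0 < t) :
      μ {ω | t < Finset.univ.inf' Finset.univ_nonempty fun k => f k ω}
        ≤ ENNReal.ofReal (1 * Real.exp (-(K / s ^ δ) * t ^ δ)) := by
    refine (measure_lt_inf'_le hindep fun k => htail k t ht).trans_eq ?_
    rw [← hK, Real.div_rpow ht.le hs.le, one_mul, neg_mul, div_mul_eq_mul_div, mul_div_assoc]
  have hΓ : Real.Gamma (p / δ + 1) ≤ p ^ p := by
    have hpδ : p / δ ≤ p := div_le_self hp0.le hδ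
    calc Real.Gamma (p / δ + 1) ≤ (max 1 (p / δ)) ^ (p / δ) := Gamma_add_one_le_rpow (by positivity)
      _ ≤ p ^ (p / δ) := by
          gcongr
          exact max_le hp hpδ
      _ ≤ p ^ p := Real.rpow_le_rpow_of_exponent_le hp hpδ
  have hscale : (K / s ^ δ) ^ (-p / δ) = (s / (K : ℝ) ^ δ⁻¹) ^ p := by
    rw [neg_div, Real.rpow_neg (by positivity), ← Real.inv_rpow (by positivity), inv_div,
      Real.div_rpow (by positivity) hK0.le, Real.div_rpow hs.le (by positivity),
      ← Real.rpow_mul hs.le, ← Real.rpow_mul hK0.le]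
    congr 2 <;> field_simp
  refine eLpNorm_le_of_lintegral_rpow_le hmin0 hp0 (by positivity) ?_
  refine (lintegral_rpow_le_of_tail hmin0 (measurable_inf' hf) zero_le_one (by positivity) hδ0 hp0
    htail').trans (ENNReal.ofReal_le_ofReal ?_)
  rw [one_mul, hscale, mul_div_right_comm, Real.mul_rpow (by positivity) hp0.le]
  gcongr

end Moments

section MonteCarlo

variable {Ω : Type*} [MeasurableSpace Ω] {P : Measure Ω} {D : ℕ}

/-- The maximum distance of the first `n` coordinates. -/
def headDist (n : ℕ) (ϑ θ : Fin D → ℝ) : ℝ :=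
  ‖fun i : Fin D => if (i : ℕ) < n then θ i - ϑ i else 0‖

lemma headDist_nonneg (n : ℕ) (ϑ θ : Fin D → ℝ) : 0 ≤ headDist n ϑ θ := norm_nonneg _

lemma continuous_headDist (n : ℕ) (ϑ : Fin D → ℝ) : Continuous (headDist n ϑ) := by
  refine continuous_norm.comp (continuous_pi fun i => ?_)
  split_ifs <;> fun_prop

lemma headDist_le_iff {n : ℕ} {ϑ θ : Fin D → ℝ} {t : ℝ} (ht : 0 ≤ t) :
    headDist n ϑ θ ≤ t ↔ ∀ i : Fin D, (i : ℕ) < n → |θ i - ϑ i| ≤ t := by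
  unfold headDist
  rw [pi_norm_le_iff_of_nonneg ht]
  refine forall_congr' fun i => ?_
  split_ifs with h <;> simp [h, ht]

lemma abs_param_sub_le_headDist {n : ℕ} {ϑ θ : Fin D → ℝ} {k : ℕ} (hk : k < n) :
    |param θ k - param ϑ k| ≤ headDist n ϑ θ := by
  unfold param
  split_ifs with h
  · exact (headDist_le_iff (headDist_nonneg n ϑ θ)).1 le_rfl ⟨k, h⟩ hk
  · simpa using headDist_nonneg n ϑ θ

lemma ofReal_le_volume_inter {c t x : ℝ} (hx : |x| ≤ c) (ht : 0 ≤ t) (htc : t ≤ 2 * c) :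
    ENNReal.ofReal t ≤ volume (Set.Icc (-c) c ∩ Set.Icc (x - t) (x + t)) := by
  have ⟨hx1, hx2⟩ := abs_le.1 hx
  rw [Set.Icc_inter_Icc, Real.volume_Icc]
  refine ENNReal.ofReal_le_ofReal (le_sub_iff_add_le'.2 (le_min ?_ ?_)) <;>
    rw [← le_sub_iff_add_le] <;> exact max_le (by linarith) (by linarith)

lemma ofReal_div_pow_le_cond_headDist_le {n : ℕ} (hn : n ≤ D) {c t : ℝ} (hc : 0 < c) (ht : 0 ≤ t)
    (htc : t ≤ 2 * c) {ϑ : Fin D → ℝ} (hϑ : ∀ i, |ϑ i| ≤ c) :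
    ENNReal.ofReal ((t / (2 * c)) ^ n)
      ≤ (volume : Measure (Fin D → ℝ))[{θ | headDist n ϑ θ ≤ t} | cube D (-c) c] := by
  obtain ⟨m, rfl⟩ := Nat.exists_eq_add_of_le hn
  let box : Set (Fin (n + m) → ℝ) := Set.univ.pi fun i =>
    if (i : ℕ) < n then Set.Icc (-c) c ∩ Set.Icc (ϑ i - t) (ϑ i + t) else Set.Icc (-c) c
  have hbox : box ⊆ cube (n + m) (-c) c ∩ {θ | headDist n ϑ θ ≤ t} := fun θ hθ => by
    have hmem (i) : θ i ∈ Set.Icc (-c) c := by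
      have := hθ i trivial
      dsimp only at this
      split_ifs at this
      exacts [this.1, this]
    refine ⟨⟨fun i => (hmem i).1, fun i => (hmem i).2⟩, (headDist_le_iff ht).2 fun i hi => ?_⟩
    have := hθ i trivial
    simp only [if_pos hi] at this
    exact abs_le.2 ⟨by linarith [this.2.1], by linarith [this.2.2]⟩
  have hvol : ENNReal.ofReal t ^ n * ENNReal.ofReal (2 * c) ^ m ≤ volume box := by
    rw [volume_pi_pi, Fin.prod_univ_add]
    refine mul_le_mul' ?_ ?_
    · rw [← Fin.prod_const]
      exact Finset.prod_le_prod' fun i _ => by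
        simpa using ofReal_le_volume_inter (hϑ (Fin.castAdd m i)) ht htc
    · simp [Real.volume_Icc, two_mul]
  have hpow0 (k : ℕ) : ENNReal.ofReal (2 * c) ^ k ≠ 0 :=
    pow_ne_zero k (ENNReal.ofReal_pos.2 (by linarith)).ne'
  have htop (k : ℕ) : ENNReal.ofReal (2 * c) ^ k ≠ ⊤ := ENNReal.pow_ne_top ENNReal.ofReal_ne_top
  rw [cond_apply measurableSet_Icc]
  calc ENNReal.ofReal ((t / (2 * c)) ^ n)
    _ = (ENNReal.ofReal (2 * c) ^ (n + m))⁻¹ *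
          (ENNReal.ofReal t ^ n * ENNReal.ofReal (2 * c) ^ m) := by
        rw [ENNReal.ofReal_pow (by positivity), ENNReal.ofReal_div_of_pos (by positivity), pow_add,
          ENNReal.mul_inv (.inl (hpow0 n)) (.inl (htop n)), mul_mul_mul_comm,
          ENNReal.inv_mul_cancel (hpow0 m) (htop m), mul_one, ENNReal.div_eq_inv_mul,
          mul_pow, ENNReal.inv_pow]
    _ ≤ (volume (cube (n + m) (-c) c))⁻¹ *
          volume (cube (n + m) (-c) c ∩ {θ | headDist n ϑ θ ≤ t}) := by
        refine mul_le_mul' (le_of_eq ?_) (hvol.trans (measure_mono hbox))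
        simp [cube, Real.volume_Icc_pi, two_mul]

lemma measure_lt_headDist_le [IsProbabilityMeasure P] {Θ : Ω → Fin D → ℝ} (hΘ : Measurable Θ)
    {c : ℝ} (hc : 0 < c)
    (hunif : P.map Θ = (volume : Measure (Fin D → ℝ))[|cube D (-c) c]) {n : ℕ} (hn : n ≤ D)
    {ϑ : Fin D → ℝ} (hϑ : ∀ i, |ϑ i| ≤ c) {t : ℝ} (ht : 0 < t) :
    P {ω | t < headDist n ϑ (Θ ω)} ≤ ENNReal.ofReal (Real.exp (-(t / (2 * c)) ^ n)) := by
  have hmeas (t : ℝ) : MeasurableSet {θ : Fin D → ℝ | headDist n ϑ θ ≤ t} :=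
    (isClosed_le (continuous_headDist n ϑ) continuous_const).measurableSet
  have : IsProbabilityMeasure (volume : Measure (Fin D → ℝ))[|cube D (-c) c] :=
    hunif ▸ Measure.isProbabilityMeasure_map hΘ.aemeasurable
  calc P {ω | t < headDist n ϑ (Θ ω)}
    _ = (volume : Measure (Fin D → ℝ))[{θ | headDist n ϑ θ ≤ t}ᶜ | cube D (-c) c] := by
        rw [← hunif, Measure.map_apply hΘ (hmeas t).compl]
        simp only [Set.compl_ofPred, Set.preimage_ofPred_eq, not_le]
    _ ≤ ENNReal.ofReal (Real.exp (-(t / (2 * c)) ^ n)) := by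
        rw [prob_compl_eq_one_sub (hmeas t)]
        rcases le_total t (2 * c) with h | h
        · refine (tsub_le_tsub_left
            (ofReal_div_pow_le_cond_headDist_le hn hc ht.le h hϑ) 1).trans ?_
          rw [← ENNReal.ofReal_one, ← ENNReal.ofReal_sub _ (by positivity)]
          exact ENNReal.ofReal_le_ofReal (Real.one_sub_le_exp_neg _)
        · have hone := (ofReal_div_pow_le_cond_headDist_le hn hc (by linarith) le_rfl hϑ).trans
            (measure_mono (t := {θ | headDist n ϑ θ ≤ t}) fun θ hθ => le_trans hθ h)
          rw [div_self (by linarith), one_pow, ENNReal.ofReal_one] at hone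
          rw [tsub_eq_zero_of_le hone]
          exact zero_le

lemma eLpNorm_min_headDist_le [IsProbabilityMeasure P] {ι : Type*} [Fintype ι] [Nonempty ι]
    {Θ : ι → Ω → Fin D → ℝ} (hΘ : ∀ k, Measurable (Θ k)) (hindep : iIndepFun Θ P) {c : ℝ}
    (hc : 0 < c) (hunif : ∀ k, P.map (Θ k) = (volume : Measure (Fin D → ℝ))[|cube D (-c) c])
    {n : ℕ} (hn : 1 ≤ n) (hnD : n ≤ D) {ϑ : Fin D → ℝ} (hϑ : ∀ i, |ϑ i| ≤ c) {p : ℝ}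
    (hp : 1 ≤ p) :
    eLpNorm (fun ω => Finset.univ.inf' Finset.univ_nonempty fun k => headDist n ϑ (Θ k ω))
      (ENNReal.ofReal p) P ≤ ENNReal.ofReal (2 * c * p / (Fintype.card ι : ℝ) ^ (n : ℝ)⁻¹) := by
  have hg : Measurable (headDist n ϑ) := (continuous_headDist n ϑ).measurable
  refine eLpNorm_inf'_le (fun k => hg.comp (hΘ k)) (fun k ω => headDist_nonneg _ _ _)
    (hindep.comp _ fun _ => hg) (by linarith) (by exact_mod_cast hn) hp fun k t ht => ?_
  rw [Real.rpow_natCast]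
  exact measure_lt_headDist_le (hΘ k) hc (hunif k) hnD hϑ ht

end MonteCarlo

section Concentration

variable {Ω : Type*} [MeasurableSpace Ω] {P : Measure Ω}

lemma measure_lt_abs_mean_sub_le [IsProbabilityMeasure P] {ι : Type*} [Fintype ι] [Nonempty ι]
    {V : ι → Ω → ℝ} (hV : ∀ j, Measurable (V j)) (hindep : iIndepFun V P) {r s m : ℝ}
    (hrs : r < s) (hmem : ∀ j ω, V j ω ∈ Set.Icc r s) (hm : ∀ j, ∫ ω, V j ω ∂P = m) {t : ℝ}
    (ht : 0 ≤ t) :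
    P {ω | t < |1 / (Fintype.card ι : ℝ) * ∑ j, V j ω - m|}
      ≤ ENNReal.ofReal (2 * Real.exp (-(2 * Fintype.card ι / (s - r) ^ 2) * t ^ 2)) := by
  obtain ⟨M, hM⟩ : ∃ M : ℝ, M = Fintype.card ι := ⟨_, rfl⟩
  rw [← hM]
  have hM0 : 0 < M := by rw [hM]; exact_mod_cast Fintype.card_pos
  have hrs0 : 0 < s - r := sub_pos.2 hrs
  have hsub (j) : HasSubgaussianMGF (fun ω => V j ω - m) ((‖s - r‖₊ / 2) ^ 2) P := by
    rw [← hm j]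
    exact hasSubgaussianMGF_of_mem_Icc (hV j).aemeasurable (.of_forall (hmem j))
  have hindep' : iIndepFun (fun j ω => V j ω - m) P :=
    hindep.comp (fun _ x => x - m) fun _ => by fun_prop
  have hsum := HasSubgaussianMGF.sum_of_iIndepFun (s := Finset.univ) hindep' fun j _ => hsub j
  have hparam : ((∑ _j : ι, ((‖s - r‖₊ / 2) ^ 2) : NNReal) : ℝ) = M * ((s - r) / 2) ^ 2 := by
    simp [hM, abs_of_pos hrs0]
  have hexp : Real.exp (-(M * t) ^ 2 / (2 * (M * ((s - r) / 2) ^ 2)))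
      = Real.exp (-(2 * M / (s - r) ^ 2) * t ^ 2) := by
    congr 1
    field_simp
  have hcentred (ω) : ∑ j, (V j ω - m) = M * (1 / M * ∑ j, V j ω - m) := by
    rw [Finset.sum_sub_distrib, Finset.sum_const, Finset.card_univ, nsmul_eq_mul, ← hM]
    field_simp
  have hupper := hsum.measure_ge_le (ε := M * t) (by positivity)
  have hlower := hsum.neg.measure_ge_le (ε := M * t) (by positivity)
  rw [hparam, hexp, measureReal_def, ← ENNReal.le_ofReal_iff_toReal_le (measure_ne_top _ _)
    (Real.exp_pos _).le] at hupper hlower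
  rw [two_mul, ENNReal.ofReal_add (Real.exp_pos _).le (Real.exp_pos _).le]
  refine (measure_mono fun ω hω => ?_).trans
    ((measure_union_le _ _).trans (add_le_add hupper hlower))
  simp only [Set.mem_union, Set.mem_ofPred_eq, Pi.neg_apply, hcentred, ← mul_neg,
    mul_le_mul_iff_right₀ hM0]
  exact (lt_abs.1 hω).imp le_of_lt le_of_lt

lemma lintegral_abs_mean_sub_rpow_le [IsProbabilityMeasure P] {ι : Type*} [Fintype ι] [Nonempty ι]
    {V : ι → Ω → ℝ} (hV : ∀ j, Measurable (V j)) (hindep : iIndepFun V P) {r s m : ℝ}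
    (hrs : r < s) (hmem : ∀ j ω, V j ω ∈ Set.Icc r s) (hm : ∀ j, ∫ ω, V j ω ∂P = m) {q : ℝ}
    (hq : 2 ≤ q) :
    ∫⁻ ω, ENNReal.ofReal (|1 / (Fintype.card ι : ℝ) * ∑ j, V j ω - m| ^ q) ∂P
      ≤ ENNReal.ofReal (((s - r) * √q / √(Fintype.card ι : ℝ)) ^ q) := by
  have htail (t : ℝ) (ht : 0 < t) :
      P {ω | t < |1 / (Fintype.card ι : ℝ) * ∑ j, V j ω - m|}
        ≤ ENNReal.ofReal (2 * Real.exp (-(2 * Fintype.card ι / (s - r) ^ 2) * t ^ (2 : ℝ))) := by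
    rw [Real.rpow_two]
    exact measure_lt_abs_mean_sub_le hV hindep hrs hmem hm ht.le
  obtain ⟨M, hM⟩ : ∃ M : ℝ, M = Fintype.card ι := ⟨_, rfl⟩
  rw [← hM] at htail ⊢
  have hM0 : 0 < M := by rw [hM]; exact_mod_cast Fintype.card_pos
  have hrs0 : 0 < s - r := sub_pos.2 hrs
  refine (lintegral_rpow_le_of_tail (fun ω => abs_nonneg _) (by fun_prop) zero_le_two
    (by positivity) zero_lt_two (by linarith) htail).trans (ENNReal.ofReal_le_ofReal ?_)
  have hΓ : Real.Gamma (q / 2 + 1) ≤ (q / 2) ^ (q / 2) := by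
    simpa only [max_eq_right (show 1 ≤ q / 2 by linarith)] using
      Gamma_add_one_le_rpow (q := q / 2) (by linarith)
  have hfour : (2 : ℝ) ≤ 4 ^ (q / 2) :=
    calc (2 : ℝ) ≤ 4 ^ (1 : ℝ) := by norm_num
      _ ≤ 4 ^ (q / 2) := Real.rpow_le_rpow_of_exponent_le (by norm_num) (by linarith)
  have hsq : 4 * ((s - r) ^ 2 / (2 * M)) * (q / 2) = ((s - r) * √q / √M) ^ 2 := by
    rw [div_pow, mul_pow, Real.sq_sqrt (by linarith), Real.sq_sqrt hM0.le]
    field_simp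
    norm_num
  calc 2 * (2 * M / (s - r) ^ 2) ^ (-q / 2) * Real.Gamma (q / 2 + 1)
    _ ≤ 4 ^ (q / 2) * (2 * M / (s - r) ^ 2) ^ (-q / 2) * (q / 2) ^ (q / 2) := by gcongr
    _ = (4 * ((s - r) ^ 2 / (2 * M)) * (q / 2)) ^ (q / 2) := by
        rw [neg_div, Real.rpow_neg (by positivity), ← Real.inv_rpow (by positivity), inv_div,
          Real.mul_rpow (by positivity) (by positivity),
          Real.mul_rpow (by positivity) (by positivity)]
    _ = ((s - r) * √q / √M) ^ q := by
        rw [hsq, ← Real.rpow_natCast, ← Real.rpow_mul (by positivity), Nat.cast_two,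
          mul_div_cancel₀ q two_ne_zero]

lemma eLpNorm_const_ofReal [IsProbabilityMeasure P] {e p : ℝ} (he : 0 ≤ e) (hp : 0 < p) :
    eLpNorm (fun _ : Ω => e) (ENNReal.ofReal p) P = ENNReal.ofReal e := by
  rw [eLpNorm_const _ (ENNReal.ofReal_pos.2 hp).ne' (NeZero.ne P), measure_univ, ENNReal.one_rpow,
    mul_one, Real.enorm_of_nonneg he]

lemma abs_le_sum_rpow {σ : Type*} [Fintype σ] (z : σ → ℝ) {q : ℝ} (hq : 0 < q) (s : σ) :
    |z s| ≤ (∑ s, |z s| ^ q) ^ (1 / q) := by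
  calc |z s| = (|z s| ^ q) ^ (1 / q) := by
        rw [← Real.rpow_mul (abs_nonneg _), mul_one_div_cancel hq.ne', Real.rpow_one]
    _ ≤ _ := by
        gcongr
        exact Finset.single_le_sum (f := fun s => |z s| ^ q) (fun s _ => by positivity)
          (Finset.mem_univ s)

lemma eLpNorm_sum_rpow_le {σ : Type*} [Fintype σ] {Z : σ → Ω → ℝ}
    (hZm : ∀ s, Measurable (Z s)) {q B : ℝ} (hq : 0 < q) (hB : 0 ≤ B)
    (hZ : ∀ s, ∫⁻ ω, ENNReal.ofReal (|Z s ω| ^ q) ∂P ≤ ENNReal.ofReal (B ^ q)) :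
    eLpNorm (fun ω => (∑ s, |Z s ω| ^ q) ^ (1 / q)) (ENNReal.ofReal q) P
      ≤ ENNReal.ofReal ((Fintype.card σ : ℝ) ^ (1 / q) * B) := by
  refine eLpNorm_le_of_lintegral_rpow_le (fun ω => by positivity) hq (by positivity) ?_
  calc ∫⁻ ω, ENNReal.ofReal (((∑ s, |Z s ω| ^ q) ^ (1 / q)) ^ q) ∂P
      = ∫⁻ ω, ∑ s, ENNReal.ofReal (|Z s ω| ^ q) ∂P := by
        refine lintegral_congr fun ω => ?_
        rw [← Real.rpow_mul (by positivity), one_div_mul_cancel hq.ne', Real.rpow_one,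
          ENNReal.ofReal_sum_of_nonneg fun s _ => by positivity]
    _ = ∑ s, ∫⁻ ω, ENNReal.ofReal (|Z s ω| ^ q) ∂P :=
        lintegral_finsetSum _ fun s _ => by have := hZm s; fun_prop
    _ ≤ ∑ _s : σ, ENNReal.ofReal (B ^ q) := Finset.sum_le_sum fun s _ => hZ s
    _ = ENNReal.ofReal (((Fintype.card σ : ℝ) ^ (1 / q) * B) ^ q) := by
        rw [Finset.sum_const, Finset.card_univ, nsmul_eq_mul, Real.mul_rpow (by positivity) hB,
          ← Real.rpow_mul (by positivity), one_div_mul_cancel hq.ne', Real.rpow_one,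
          ENNReal.ofReal_mul (by positivity), ENNReal.ofReal_natCast]

end Concentration

section Risk

variable {Ω 𝒳 : Type*} [MeasurableSpace Ω] [MeasurableSpace 𝒳] {P : Measure Ω} {u v : ℝ}

lemma abs_sub_sq_mem_Icc (x y : Set.Icc u v) : |(x : ℝ) - y| ^ 2 ∈ Set.Icc 0 ((v - u) ^ 2) := by
  have h : |(x : ℝ) - y| ≤ v - u := abs_sub_le_of_le_of_le x.2.1 x.2.2 y.2.1 y.2.2
  exact ⟨by positivity, by gcongr⟩

lemma abs_sq_sub_sq_le (x y t : Set.Icc u v) :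
    |(|(x : ℝ) - t| ^ 2 - |(y : ℝ) - t| ^ 2)| ≤ 2 * (v - u) * |(x : ℝ) - y| := by
  rw [sq_abs, sq_abs, show ((x : ℝ) - t) ^ 2 - (y - t) ^ 2 = (x + y - 2 * t) * (x - y) by ring,
    abs_mul]
  gcongr
  exact abs_le.2 ⟨by linarith [x.2.1, y.2.1, t.2.2], by linarith [x.2.2, y.2.2, t.2.1]⟩

lemma measurable_abs_sub_sq {f g : 𝒳 → Set.Icc u v} (hf : Measurable f) (hg : Measurable g) :
    Measurable fun x => |(f x : ℝ) - g x| ^ 2 := by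
  fun_prop

lemma integrable_abs_sub_sq {μ : Measure 𝒳} [IsFiniteMeasure μ] {f g : 𝒳 → Set.Icc u v}
    (hf : Measurable f) (hg : Measurable g) : Integrable (fun x => |(f x : ℝ) - g x| ^ 2) μ :=
  .of_mem_Icc 0 ((v - u) ^ 2) (measurable_abs_sub_sq hf hg).aemeasurable
    (.of_forall fun x => abs_sub_sq_mem_Icc (f x) (g x))

/-- The mean squared error of the predictor `f` for the response `Y` given `X`. -/
noncomputable def risk (P : Measure Ω) (X : Ω → 𝒳) (Y : Ω → Set.Icc u v) (f : 𝒳 → Set.Icc u v) :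
    ℝ :=
  ∫ ω, |(f (X ω) : ℝ) - Y ω| ^ 2 ∂P

/-- The mean squared error of the predictor `f` over the sample `(X j, Y j)`. -/
noncomputable def empRisk {ι : Type*} [Fintype ι] (X : ι → Ω → 𝒳) (Y : ι → Ω → Set.Icc u v)
    (f : 𝒳 → Set.Icc u v) (ω : Ω) : ℝ :=
  1 / (Fintype.card ι : ℝ) * ∑ j, |(f (X j ω) : ℝ) - Y j ω| ^ 2

lemma integral_mul_sub_condExp_eq_zero {Ω : Type*} {m m₀ : MeasurableSpace Ω}
    {P : Measure[m₀] Ω} (hm : m ≤ m₀) [SigmaFinite (P.trim hm)] {g Y Z : Ω → ℝ}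
    (hg : StronglyMeasurable[m] g) (hY : Integrable Y P) (hgY : Integrable (g * Y) P)
    (hgZ : Integrable (g * Z) P) (hZ : Z =ᵐ[P] P[Y | m]) : ∫ ω, g ω * (Z ω - Y ω) ∂P = 0 := by
  have heq : ∫ ω, (g * Y) ω ∂P = ∫ ω, (g * Z) ω ∂P := by
    rw [← integral_condExp hm]
    exact integral_congr_ae ((condExp_mul_of_stronglyMeasurable_left hg hgY hY).trans
      (hZ.symm.mono fun ω h => congrArg (g ω * ·) h))
  calc ∫ ω, g ω * (Z ω - Y ω) ∂P
    _ = ∫ ω, (g * Z) ω - (g * Y) ω ∂P := integral_congr_ae (.of_forall fun ω => mul_sub ..)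
    _ = 0 := by rw [integral_sub hgZ hgY, heq, sub_self]

lemma risk_eq_integral_add_risk [IsProbabilityMeasure P] {X : Ω → 𝒳} {Y : Ω → Set.Icc u v}
    (hX : Measurable X) (hY : Measurable Y) {f E : 𝒳 → Set.Icc u v} (hf : Measurable f)
    (hEm : Measurable E) (hE : (fun ω => (E (X ω) : ℝ)) =ᵐ[P]
      P[fun ω => (Y ω : ℝ) | MeasurableSpace.comap X inferInstance]) :
    risk P X Y f = ∫ x, |(f x : ℝ) - E x| ^ 2 ∂(P.map X) + risk P X Y E := by
  have hbdd {g : Ω → Set.Icc u v} (hg : Measurable g) : Integrable (fun ω => (g ω : ℝ)) P :=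
    .of_mem_Icc u v hg.subtype_val.aemeasurable (.of_forall fun ω => (g ω).2)
  have hfE : Measurable fun x => (f x : ℝ) - E x := hf.subtype_val.sub hEm.subtype_val
  have hmul {g : Ω → ℝ} (hg : Integrable g P) :
      Integrable ((fun ω => (f (X ω) : ℝ) - E (X ω)) * g) P :=
    hg.bdd_mul (hfE.comp hX).aestronglyMeasurable (.of_forall fun ω => by
      rw [Real.norm_eq_abs]
      exact abs_sub_le_of_le_of_le (f (X ω)).2.1 (f (X ω)).2.2 (E (X ω)).2.1 (E (X ω)).2.2)
  have hEX := hbdd (hEm.comp hX)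
  have hcross : ∫ ω, ((f (X ω) : ℝ) - E (X ω)) * (E (X ω) - Y ω) ∂P = 0 :=
    integral_mul_sub_condExp_eq_zero hX.comap_le
      (hfE.comp (comap_measurable X)).stronglyMeasurable (hbdd hY) (hmul (hbdd hY)) (hmul hEX) hE
  have hsq : Integrable (fun ω => |(f (X ω) : ℝ) - E (X ω)| ^ 2) P :=
    integrable_abs_sub_sq (hf.comp hX) (hEm.comp hX)
  have hcrossInt :
      Integrable (fun ω => 2 * (((f (X ω) : ℝ) - E (X ω)) * (E (X ω) - Y ω))) P :=
    (hmul (hEX.sub (hbdd hY))).const_mul 2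
  have hsum : Integrable (fun ω => |(f (X ω) : ℝ) - E (X ω)| ^ 2
      + 2 * (((f (X ω) : ℝ) - E (X ω)) * (E (X ω) - Y ω))) P := hsq.add hcrossInt
  have hEY : Integrable (fun ω => |(E (X ω) : ℝ) - Y ω| ^ 2) P :=
    integrable_abs_sub_sq (hEm.comp hX) hY
  calc risk P X Y f
    _ = ∫ ω, (|(f (X ω) : ℝ) - E (X ω)| ^ 2 + 2 * (((f (X ω) : ℝ) - E (X ω)) * (E (X ω) - Y ω)))
          + |(E (X ω) : ℝ) - Y ω| ^ 2 ∂P := by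
        refine integral_congr_ae (.of_forall fun ω => ?_)
        simp only [sq_abs]
        ring
    _ = ∫ ω, |(f (X ω) : ℝ) - E (X ω)| ^ 2 ∂P + risk P X Y E := by
        rw [integral_add hsum hEY, integral_add hsq hcrossInt,
          integral_const_mul, hcross, mul_zero, add_zero, risk]
    _ = _ := by
        rw [integral_map hX.aemeasurable (measurable_abs_sub_sq hf hEm).aestronglyMeasurable]

lemma abs_empRisk_sub_empRisk_le {Ω 𝒳 ι : Type*} [Fintype ι] [Nonempty ι] (huv : u ≤ v)
    {X : ι → Ω → 𝒳} {Y : ι → Ω → Set.Icc u v} {f g : 𝒳 → Set.Icc u v} {ε : ℝ}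
    (h : ∀ x, |(f x : ℝ) - g x| ≤ ε) (ω : Ω) :
    |empRisk X Y f ω - empRisk X Y g ω| ≤ 2 * (v - u) * ε := by
  have hM : (0 : ℝ) < Fintype.card ι := by exact_mod_cast Fintype.card_pos
  have := sub_nonneg.2 huv
  unfold empRisk
  rw [← mul_sub, ← Finset.sum_sub_distrib, abs_mul, abs_of_pos (by positivity), one_div,
    inv_mul_le_iff₀ hM, ← nsmul_eq_mul]
  refine (Finset.abs_sum_le_sum_abs _ _).trans (Finset.sum_le_card_nsmul _ _ _ fun j _ => ?_)
  exact (abs_sq_sub_sq_le _ _ (Y j ω)).trans (by gcongr; exact h _)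

lemma abs_risk_sub_risk_le [IsProbabilityMeasure P] (huv : u ≤ v) {X : Ω → 𝒳}
    {Y : Ω → Set.Icc u v} (hX : Measurable X) (hY : Measurable Y) {f g : 𝒳 → Set.Icc u v}
    (hf : Measurable f) (hg : Measurable g) {ε : ℝ} (h : ∀ x, |(f x : ℝ) - g x| ≤ ε) :
    |risk P X Y f - risk P X Y g| ≤ 2 * (v - u) * ε := by
  have := sub_nonneg.2 huv
  have hint {f : 𝒳 → Set.Icc u v} (hf : Measurable f) :
      Integrable (fun ω => |(f (X ω) : ℝ) - Y ω| ^ 2) P := integrable_abs_sub_sq (hf.comp hX) hY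
  rw [risk, risk, ← integral_sub (hint hf) (hint hg), ← Real.norm_eq_abs]
  refine (norm_integral_le_of_norm_le_const (C := 2 * (v - u) * ε)
    (.of_forall fun ω => ?_)).trans_eq (by simp)
  exact (abs_sq_sub_sq_le _ _ (Y ω)).trans (by gcongr; exact h _)

variable {ι : Type*} [Fintype ι] {X : ι → Ω → 𝒳} {Y : ι → Ω → Set.Icc u v} {X₀ : Ω → 𝒳}
  {Y₀ : Ω → Set.Icc u v}

lemma integral_le_add_of_empRisk_le [IsProbabilityMeasure P] [Nonempty ι] (huv : u ≤ v)
    (hX₀ : Measurable X₀) (hY₀ : Measurable Y₀) {f f' g E : 𝒳 → Set.Icc u v} (hf : Measurable f)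
    (hg : Measurable g) (hEm : Measurable E) (hE : (fun ω => (E (X₀ ω) : ℝ)) =ᵐ[P]
      P[fun ω => (Y₀ ω : ℝ) | MeasurableSpace.comap X₀ inferInstance])
    {ω : Ω} {γ ε : ℝ} (hfγ : |empRisk X Y f ω - risk P X₀ Y₀ f| ≤ γ)
    (hgγ : |empRisk X Y g ω - risk P X₀ Y₀ g| ≤ γ)
    (hff' : empRisk X Y f ω ≤ empRisk X Y f' ω) (hf'g : ∀ x, |(f' x : ℝ) - g x| ≤ ε) :
    ∫ x, |(f x : ℝ) - E x| ^ 2 ∂(P.map X₀)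
      ≤ ∫ x, |(g x : ℝ) - E x| ^ 2 ∂(P.map X₀) + 2 * γ + 2 * (v - u) * ε := by
  have hopt := abs_empRisk_sub_empRisk_le (X := X) (Y := Y) huv hf'g ω
  rw [risk_eq_integral_add_risk hX₀ hY₀ hf hEm hE] at hfγ
  rw [risk_eq_integral_add_risk hX₀ hY₀ hg hEm hE] at hgγ
  linarith [(abs_le.1 hfγ).1, (abs_le.1 hgγ).2, (abs_le.1 hopt).2]

lemma measurable_empRisk (hX : ∀ j, Measurable (X j)) (hY : ∀ j, Measurable (Y j))
    {f : 𝒳 → Set.Icc u v} (hf : Measurable f) : Measurable (empRisk X Y f) :=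
  (Finset.measurable_sum _ fun j _ =>
    measurable_abs_sub_sq (hf.comp (hX j)) (hY j)).const_mul _

variable [IsProbabilityMeasure P] [Nonempty ι]

lemma lintegral_abs_empRisk_sub_risk_rpow_le (huv : u < v) (hX : ∀ j, Measurable (X j))
    (hY : ∀ j, Measurable (Y j)) (hindep : iIndepFun (fun j ω => (X j ω, Y j ω)) P)
    (hident : ∀ j, IdentDistrib (fun ω => (X j ω, Y j ω)) (fun ω => (X₀ ω, Y₀ ω)) P P)
    {f : 𝒳 → Set.Icc u v} (hf : Measurable f) {q : ℝ} (hq : 2 ≤ q) :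
    ∫⁻ ω, ENNReal.ofReal (|empRisk X Y f ω - risk P X₀ Y₀ f| ^ q) ∂P
      ≤ ENNReal.ofReal (((v - u) ^ 2 * √q / √(Fintype.card ι : ℝ)) ^ q) := by
  have hloss : Measurable fun z : 𝒳 × Set.Icc u v => |(f z.1 : ℝ) - z.2| ^ 2 :=
    measurable_abs_sub_sq (hf.comp measurable_fst) measurable_snd
  have h := lintegral_abs_mean_sub_rpow_le (V := fun j ω => |(f (X j ω) : ℝ) - Y j ω| ^ 2)
    (fun j => measurable_abs_sub_sq (hf.comp (hX j)) (hY j))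
    (hindep.comp (fun _ z => |(f z.1 : ℝ) - z.2| ^ 2) fun _ => hloss)
    (pow_pos (sub_pos.2 huv) 2) (fun j ω => abs_sub_sq_mem_Icc _ (Y j ω))
    (fun j => ((hident j).comp hloss).integral_eq) hq
  rw [sub_zero] at h
  exact h

lemma exists_finite_deviation (huv : u < v) (hX : ∀ j, Measurable (X j))
    (hY : ∀ j, Measurable (Y j)) (hindep : iIndepFun (fun j ω => (X j ω, Y j ω)) P)
    (hident : ∀ j, IdentDistrib (fun ω => (X j ω, Y j ω)) (fun ω => (X₀ ω, Y₀ ω)) P P)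
    {σ : Type*} [Fintype σ] {g : σ → 𝒳 → Set.Icc u v} (hg : ∀ s, Measurable (g s)) {p q : ℝ}
    (hpq : p ≤ q) (hq : 2 ≤ q) (hcard : (Fintype.card σ : ℝ) ≤ Real.exp q) :
    ∃ S : Ω → ℝ, Measurable S ∧ (∀ s ω, |empRisk X Y (g s) ω - risk P X₀ Y₀ (g s)| ≤ S ω) ∧
      eLpNorm S (ENNReal.ofReal p) P
        ≤ ENNReal.ofReal (Real.exp 1 * ((v - u) ^ 2 * √q / √(Fintype.card ι : ℝ))) := by
  have hq0 : 0 < q := zero_lt_two.trans_le hq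
  let Z (s : σ) (ω : Ω) : ℝ := empRisk X Y (g s) ω - risk P X₀ Y₀ (g s)
  have hZ (s) : Measurable (Z s) := (measurable_empRisk hX hY (hg s)).sub_const _
  have hSm : Measurable fun ω => (∑ s, |Z s ω| ^ q) ^ (1 / q) := by fun_prop
  refine ⟨_, hSm, fun s ω => abs_le_sum_rpow (fun s => Z s ω) hq0 s, ?_⟩
  refine (eLpNorm_le_eLpNorm_of_exponent_le (ENNReal.ofReal_le_ofReal hpq)
    hSm.aestronglyMeasurable).trans ((eLpNorm_sum_rpow_le hZ hq0 (by positivity) fun s =>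
      lintegral_abs_empRisk_sub_risk_rpow_le huv hX hY hindep hident (hg s) hq).trans
    (ENNReal.ofReal_le_ofReal ?_))
  gcongr
  calc (Fintype.card σ : ℝ) ^ (1 / q) ≤ (Real.exp q) ^ (1 / q) := by gcongr
    _ = Real.exp 1 := by rw [← Real.exp_mul, mul_one_div_cancel hq0.ne']

lemma exists_uniform_deviation_of_net (huv : u < v) (hX : ∀ j, Measurable (X j))
    (hY : ∀ j, Measurable (Y j)) (hindep : iIndepFun (fun j ω => (X j ω, Y j ω)) P)
    (hX₀ : Measurable X₀) (hY₀ : Measurable Y₀)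
    (hident : ∀ j, IdentDistrib (fun ω => (X j ω, Y j ω)) (fun ω => (X₀ ω, Y₀ ω)) P P)
    {F : Set (𝒳 → Set.Icc u v)} (hF : ∀ f ∈ F, Measurable f) {σ : Type*} [Fintype σ]
    {g : σ → 𝒳 → Set.Icc u v} (hg : ∀ s, Measurable (g s)) {ε : ℝ} (hε : 0 ≤ ε)
    (hnet : ∀ f ∈ F, ∃ s, ∀ x, |(f x : ℝ) - g s x| ≤ ε) {p q : ℝ} (hp : 1 ≤ p) (hpq : p ≤ q)
    (hq : 2 ≤ q) (hcard : (Fintype.card σ : ℝ) ≤ Real.exp q) :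
    ∃ G : Ω → ℝ, Measurable G ∧ (∀ f ∈ F, ∀ ω, |empRisk X Y f ω - risk P X₀ Y₀ f| ≤ G ω) ∧
      eLpNorm G (ENNReal.ofReal p) P ≤ ENNReal.ofReal
        (Real.exp 1 * ((v - u) ^ 2 * √q / √(Fintype.card ι : ℝ)) + 4 * (v - u) * ε) := by
  have := sub_pos.2 huv
  obtain ⟨S, hSm, hSdev, hSnorm⟩ := exists_finite_deviation huv hX hY hindep hident hg hpq hq hcard
  refine ⟨fun ω => S ω + 4 * (v - u) * ε, hSm.add_const _, fun f hf ω => ?_, ?_⟩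
  · obtain ⟨s, hs⟩ := hnet f hf
    have hemp := abs_le.1 (abs_empRisk_sub_empRisk_le (X := X) (Y := Y) huv.le hs ω)
    have hrisk := abs_le.1 (abs_risk_sub_risk_le (P := P) huv.le hX₀ hY₀ (hF f hf) (hg s) hs)
    have hdev := abs_le.1 (hSdev s ω)
    exact abs_le.2 ⟨by linarith [hemp.1, hrisk.2, hdev.1], by linarith [hemp.2, hrisk.1, hdev.2]⟩
  · have hp1 : (1 : ENNReal) ≤ ENNReal.ofReal p := ENNReal.one_le_ofReal.2 hp
    rw [ENNReal.ofReal_add (by positivity) (by positivity)]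
    exact (eLpNorm_add_le hSm.aestronglyMeasurable aestronglyMeasurable_const hp1).trans
      (add_le_add hSnorm (eLpNorm_const_ofReal (by positivity) (by positivity)).le)

end Risk

section Predictor

variable {D d depth : ℕ} {l : ℕ → ℕ} {a b u v : ℝ} (h0 : l 0 = d) (h1 : l depth = 1)
  (hdepth : 1 ≤ depth) (huv : u ≤ v)

/-- The rectified clipped network with parameter vector `θ` as a predictor `[a, b]^d → [u, v]`. -/
def predictor (θ : Fin D → ℝ) (x : cube d a b) : Set.Icc u v :=
  ⟨realNN h0 h1 u v θ x, realNN_mem_Icc h0 h1 hdepth huv θ x⟩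

lemma continuous_predictor : Continuous fun z : (Fin D → ℝ) × cube d a b =>
    predictor h0 h1 hdepth huv z.1 z.2 :=
  ((continuous_realNN h0 h1).comp (by fun_prop :
    Continuous fun z : (Fin D → ℝ) × cube d a b => (z.1, (z.2 : Fin d → ℝ)))).subtype_mk _

lemma measurable_predictor (θ : Fin D → ℝ) :
    Measurable (predictor (a := a) (b := b) h0 h1 hdepth huv θ) :=
  ((continuous_predictor h0 h1 hdepth huv).comp (Continuous.prodMk_right θ)).measurable

lemma abs_predictor_sub_predictor_le {β c δ : ℝ} (hβ : 1 ≤ β) (hc : 1 ≤ c) (ha : |a| ≤ c)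
    (hb : |b| ≤ c) {θ ϑ : Fin D → ℝ} (hθ : ∀ i, |θ i| ≤ β) (hϑ : ∀ i, |ϑ i| ≤ β) (hδ : 0 ≤ δ)
    (hθϑ : ∀ t < numParams l depth, |param θ t - param ϑ t| ≤ δ) (x : cube d a b) :
    |(predictor h0 h1 hdepth huv θ x : ℝ) - predictor h0 h1 hdepth huv ϑ x|
      ≤ depth * c * ((maxWidth depth l : ℝ) + 1) ^ depth * β ^ (depth - 1) * δ :=
  have hβ0 : 0 ≤ β := zero_le_one.trans hβ
  abs_realNN_sub_realNN_le h0 h1 hβ hc hδ (fun t _ => abs_param_le hβ0 hθ t)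
    (fun t _ => abs_param_le hβ0 hϑ t) hθϑ (abs_le_of_mem_cube ha hb x)

variable {E : cube d a b → Set.Icc u v} {μ : Measure (cube d a b)}

lemma sqError_nonneg (E : cube d a b → Set.Icc u v) (μ : Measure (cube d a b))
    (θ : Fin D → ℝ) : 0 ≤ sqError h0 h1 E μ θ :=
  integral_nonneg fun _ => by positivity

include hdepth huv in
lemma measurable_sqError [SFinite μ] (hE : Measurable E) :
    Measurable (sqError (D := D) h0 h1 E μ) := by
  have h : Measurable fun z : (Fin D → ℝ) × cube d a b =>
      |(predictor h0 h1 hdepth huv z.1 z.2 : ℝ) - E z.2| ^ 2 :=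
    measurable_abs_sub_sq (continuous_predictor h0 h1 hdepth huv).measurable
      (hE.comp measurable_snd)
  exact h.stronglyMeasurable.integral_prod_right.measurable

lemma sqError_le_sq [IsProbabilityMeasure μ] {θ : Fin D → ℝ} {δ : ℝ}
    (h : ∀ x : cube d a b, |realNN h0 h1 u v θ x - (E x : ℝ)| ≤ δ) :
    sqError h0 h1 E μ θ ≤ δ ^ 2 := by
  have hbound (x : cube d a b) : ‖|realNN h0 h1 u v θ x - (E x : ℝ)| ^ 2‖ ≤ δ ^ 2 := by
    rw [Real.norm_of_nonneg (by positivity)]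
    exact pow_le_pow_left₀ (abs_nonneg _) (h x) 2
  calc sqError h0 h1 E μ θ ≤ ‖sqError h0 h1 E μ θ‖ := Real.le_norm_self _
    _ ≤ δ ^ 2 * μ.real Set.univ := norm_integral_le_of_norm_le_const (.of_forall hbound)
    _ = δ ^ 2 := by rw [probReal_univ, mul_one]

include hdepth in
lemma integrable_sqError_rpow {Ω : Type*} [MeasurableSpace Ω] {P : Measure Ω} [IsFiniteMeasure P]
    [IsProbabilityMeasure μ] (huv : u ≤ v) (hE : Measurable E) {T : Ω → Fin D → ℝ}
    (hT : Measurable T) {p : ℝ} (hp : 0 ≤ p) :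
    Integrable (fun ω => sqError h0 h1 E μ (T ω) ^ p) P := by
  have hbound (θ : Fin D → ℝ) : sqError h0 h1 E μ θ ≤ (v - u) ^ 2 := sqError_le_sq h0 h1 fun x =>
    have hx := realNN_mem_Icc h0 h1 hdepth huv θ x
    abs_sub_le_of_le_of_le hx.1 hx.2 (E x).2.1 (E x).2.2
  exact .of_mem_Icc 0 (((v - u) ^ 2) ^ p)
    (((measurable_sqError h0 h1 hdepth huv hE).comp hT).pow_const p).aemeasurable
    (.of_forall fun ω => have h := sqError_nonneg h0 h1 E μ (T ω)
      ⟨Real.rpow_nonneg h p, Real.rpow_le_rpow h (hbound (T ω)) hp⟩)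

end Predictor

section UniformDeviation

lemma covering_le_pow {depth w : ℕ} {M B c : ℝ} (hdepth : 1 ≤ depth) (hM : 1 ≤ M) (hc : 1 ≤ c)
    (hB : 1 ≤ B) :
    8 * depth * c * ((w : ℝ) + 1) ^ depth * B ^ depth * √M
      ≤ (3 * M * B * c) ^ (3 * depth * (w + 1)) := by
  obtain ⟨n, hn⟩ : ∃ n, n = 3 * depth * (w + 1) := ⟨_, rfl⟩
  have hn0 : n ≠ 0 := hn ▸ (by positivity : 0 < 3 * depth * (w + 1)).ne'
  have hdn : depth ≤ n := by nlinarith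
  have hexp : 2 + depth + w * depth ≤ n := by nlinarith
  have hdepth3 : (depth : ℝ) ≤ 3 ^ depth := by exact_mod_cast (Nat.lt_pow_self (by norm_num)).le
  have hw3 : (w : ℝ) + 1 ≤ 3 ^ w := by exact_mod_cast Nat.lt_pow_self (by norm_num)
  have hsqrt : √M ≤ M ^ n :=
    ((Real.sqrt_le_left (by positivity)).2 (by nlinarith)).trans (le_self_pow₀ hM hn0)
  rw [← hn]
  calc 8 * depth * c * ((w : ℝ) + 1) ^ depth * B ^ depth * √M
    _ ≤ 3 ^ 2 * 3 ^ depth * c ^ n * (3 ^ w) ^ depth * B ^ n * M ^ n := by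
        gcongr
        · norm_num
        · exact le_self_pow₀ hc hn0
    _ = 3 ^ (2 + depth + w * depth) * M ^ n * B ^ n * c ^ n := by ring
    _ ≤ 3 ^ n * M ^ n * B ^ n * c ^ n := by gcongr; norm_num
    _ = (3 * M * B * c) ^ n := by simp only [mul_pow]

lemma mul_log_le_of_le_covering {depth w np n : ℕ} {M B c m : ℝ} (hdepth : 1 ≤ depth)
    (hnp : np ≤ depth * (w * (w + 1))) (hM : 1 ≤ M) (hc : 1 ≤ c) (hB : 1 ≤ B) (hn : 1 ≤ n)
    (hnH : (n : ℝ) ≤ 8 * depth * c * ((w : ℝ) + 1) ^ depth * B ^ depth * √M) (hm : 1 ≤ m)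
    (hlm : Real.log (3 * M * B * c) ≤ m) :
    np * Real.log n ≤ 2 * (depth * ((w : ℝ) + 1) ^ 2 * m) ^ 2 := by
  have hn0 : (0 : ℝ) < n := by exact_mod_cast hn
  have hlog : Real.log n ≤ 3 * depth * (w + 1) * m :=
    calc Real.log n ≤ Real.log ((3 * M * B * c) ^ (3 * depth * (w + 1))) :=
          Real.log_le_log hn0 (hnH.trans (covering_le_pow hdepth hM hc hB))
      _ = 3 * depth * (w + 1) * Real.log (3 * M * B * c) := by rw [Real.log_pow]; push_cast; ring
      _ ≤ 3 * depth * (w + 1) * m := by gcongr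
  have hnp' : (np : ℝ) ≤ depth * (w * (w + 1)) := by exact_mod_cast hnp
  have hm2 : m ≤ m ^ 2 := le_self_pow₀ hm two_ne_zero
  have hw2 : (3 : ℝ) * w ≤ 2 * (w + 1) ^ 2 := by nlinarith [sq_nonneg (w : ℝ)]
  calc np * Real.log n ≤ (depth * (w * (w + 1))) * (3 * depth * (w + 1) * m) := by gcongr
    _ = depth ^ 2 * (w + 1) ^ 2 * (3 * w * m) := by ring
    _ ≤ depth ^ 2 * (w + 1) ^ 2 * (2 * (w + 1) ^ 2 * m ^ 2) := by gcongr
    _ = 2 * (depth * ((w : ℝ) + 1) ^ 2 * m) ^ 2 := by ring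

lemma exists_parameter_net (D k : ℕ) {n : ℕ} (hn : 1 ≤ n) {B : ℝ} (hB : 0 < B) :
    ∃ S : Finset (Fin D → ℝ), S.card ≤ n ^ k ∧ (∀ ϑ ∈ S, ∀ i, |ϑ i| ≤ B) ∧
      ∀ θ : Fin D → ℝ, (∀ i, |θ i| ≤ B) → ∃ ϑ ∈ S, ∀ i < k, |param θ i - param ϑ i| ≤ B / n := by
  classical
  let par (σ : Fin k → Fin n) (i : Fin D) : ℝ :=
    if h : (i : ℕ) < k then -B + (B - -B) * (2 * σ ⟨i, h⟩ + 1) / (2 * n) else 0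
  refine ⟨Finset.univ.image par, Finset.card_image_le.trans_eq (by simp), ?_, fun θ hθ => ?_⟩
  · simp only [Finset.forall_mem_image, Finset.mem_univ, forall_const, par]
    intro σ i
    split_ifs
    · exact abs_le.2 (midpoint_mem_Icc (neg_le_self hB.le) _)
    · simpa using hB.le
  · choose σ hσ using fun i : Fin k =>
      exists_midpoint_near (neg_lt_self hB) (abs_le.1 (abs_param_le hB.le hθ (i : ℕ))) hn
    refine ⟨par σ, Finset.mem_image_of_mem _ (Finset.mem_univ _), fun i hi => ?_⟩
    have hσi := hσ ⟨i, hi⟩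
    rw [show (B - -B) / (2 * n) = B / n by field_simp; ring] at hσi
    by_cases hiD : i < D
    · simpa [param, par, hiD, hi] using hσi
    · simp only [param, hiD, dif_neg, not_false_eq_true, sub_self, abs_zero]
      positivity

lemma deviation_const_le {t x : ℝ} (ht : 0 ≤ t) (hx : 1 ≤ x) (M : ℝ) :
    Real.exp 1 * (t ^ 2 * √(2 * x ^ 2) / √M) + 4 * t * (1 / (4 * √M))
      ≤ 9 * (max 1 (t ^ 2) * x) / √M := by
  obtain ⟨Q, hQ⟩ : ∃ Q, Q = max 1 (t ^ 2) := ⟨_, rfl⟩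
  have hQ1 : 1 ≤ Q := hQ ▸ le_max_left _ _
  have htQ2 : t ^ 2 ≤ Q := hQ ▸ le_max_right _ _
  have htQ : t ≤ Q * x :=
    (show t ≤ Q by nlinarith [sq_nonneg (t - 1)]).trans (le_mul_of_one_le_right (by linarith) hx)
  have hsqrt : √(2 * x ^ 2) ≤ 2 * x := by
    rw [Real.sqrt_le_left (by positivity)]
    nlinarith
  have he : Real.exp 1 ≤ 3 := by linarith [Real.exp_one_lt_d9]
  rw [← hQ]
  calc Real.exp 1 * (t ^ 2 * √(2 * x ^ 2) / √M) + 4 * t * (1 / (4 * √M))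
    _ = (Real.exp 1 * (t ^ 2 * √(2 * x ^ 2)) + t) / √M := by ring
    _ ≤ (3 * (Q * (2 * x)) + Q * x) / √M := by gcongr
    _ ≤ 9 * (Q * x) / √M := by gcongr; nlinarith

variable {D d depth : ℕ} {l : ℕ → ℕ} {a b u v : ℝ} (h0 : l 0 = d) (h1 : l depth = 1)
  (hdepth : 1 ≤ depth)

lemma exists_predictor_net (huv : u ≤ v) {c B M m : ℝ} (hc : 1 ≤ c) (hB : 1 ≤ B) (ha : |a| ≤ c)
    (hb : |b| ≤ c) (hM : 1 ≤ M) (hm : 1 ≤ m) (hlm : Real.log (3 * M * B * c) ≤ m) :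
    ∃ S : Finset (Fin D → ℝ),
      (S.card : ℝ) ≤ Real.exp (2 * (depth * ((maxWidth depth l : ℝ) + 1) ^ 2 * m) ^ 2) ∧
      ∀ θ : Fin D → ℝ, (∀ i, |θ i| ≤ B) → ∃ ϑ ∈ S, ∀ x : cube d a b,
        |(predictor h0 h1 hdepth huv θ x : ℝ) - predictor h0 h1 hdepth huv ϑ x|
          ≤ 1 / (4 * √M) := by
  obtain ⟨w, hw⟩ : ∃ w, w = maxWidth depth l := ⟨_, rfl⟩
  obtain ⟨H, hH⟩ : ∃ H : ℝ, H = 4 * depth * c * ((w : ℝ) + 1) ^ depth * B ^ depth * √M :=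
    ⟨_, rfl⟩
  have hH1 : 1 ≤ H := by
    have hdepth' : (1 : ℝ) ≤ 4 * depth := by exact_mod_cast (by omega : 1 ≤ 4 * depth)
    have hwd : 1 ≤ ((w : ℝ) + 1) ^ depth := one_le_pow₀ (by linarith [w.cast_nonneg (α := ℝ)])
    have hBd : 1 ≤ B ^ depth := one_le_pow₀ hB
    have hsqrt : 1 ≤ √M := Real.one_le_sqrt.2 hM
    calc (1 : ℝ) = 1 * 1 * 1 * 1 * 1 := by norm_num
      _ ≤ H := by rw [hH]; gcongr
  obtain ⟨n, hHn, hnH⟩ : ∃ n : ℕ, H ≤ n ∧ (n : ℝ) ≤ 2 * H :=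
    ⟨⌈H⌉₊, Nat.le_ceil H, by linarith [Nat.ceil_lt_add_one (zero_le_one.trans hH1)]⟩
  have hn1 : 1 ≤ n := by exact_mod_cast hH1.trans hHn
  obtain ⟨S, hcard, hSB, hS⟩ := exists_parameter_net D (numParams l depth) hn1
    (zero_lt_one.trans_le hB)
  refine ⟨S, ?_, fun θ hθ => ?_⟩
  · refine (show (S.card : ℝ) ≤ (n : ℝ) ^ numParams l depth by exact_mod_cast hcard).trans ?_
    rw [← Real.log_le_iff_le_exp (by positivity), Real.log_pow, ← hw]
    exact mul_log_le_of_le_covering hdepth (hw ▸ numParams_le l depth) hM hc hB hn1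
      (hnH.trans_eq (by rw [hH]; ring)) hm hlm
  · obtain ⟨ϑ, hϑ, hθϑ⟩ := hS θ hθ
    refine ⟨ϑ, hϑ, fun x => (abs_predictor_sub_predictor_le h0 h1 hdepth huv hB hc ha hb hθ
      (hSB ϑ hϑ) (by positivity) hθϑ x).trans ?_⟩
    have hradius : depth * c * ((w : ℝ) + 1) ^ depth * B ^ (depth - 1) * (B / n)
        = H / n / (4 * √M) := by
      rw [hH, ← pow_sub_one_mul (Nat.one_le_iff_ne_zero.1 hdepth) B]
      field_simp
    rw [← hw, hradius]
    gcongr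
    exact div_le_one_of_le₀ hHn (by positivity)

theorem exists_uniform_deviation {Ω ι : Type*} [MeasurableSpace Ω] {P : Measure Ω}
    [IsProbabilityMeasure P] [Fintype ι] [Nonempty ι] (huv : u < v) {X : ι → Ω → cube d a b}
    {Y : ι → Ω → Set.Icc u v} (hX : ∀ j, Measurable (X j)) (hY : ∀ j, Measurable (Y j))
    (hindep : iIndepFun (fun j ω => (X j ω, Y j ω)) P) {X₀ : Ω → cube d a b}
    {Y₀ : Ω → Set.Icc u v} (hX₀ : Measurable X₀) (hY₀ : Measurable Y₀)
    (hident : ∀ j, IdentDistrib (fun ω => (X j ω, Y j ω)) (fun ω => (X₀ ω, Y₀ ω)) P P)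
    {c B p : ℝ} (hc : 1 ≤ c) (hB : 1 ≤ B) (ha : |a| ≤ c) (hb : |b| ≤ c) (hp : 1 ≤ p) :
    ∃ G : Ω → ℝ, Measurable G ∧
      (∀ θ : Fin D → ℝ, (∀ i, |θ i| ≤ B) → ∀ ω,
        |empRisk X Y (predictor h0 h1 hdepth huv.le θ) ω
          - risk P X₀ Y₀ (predictor h0 h1 hdepth huv.le θ)| ≤ G ω) ∧
      eLpNorm G (ENNReal.ofReal p) P ≤ ENNReal.ofReal (9 * max 1 ((v - u) ^ 2) * depth *
        ((maxWidth depth l : ℝ) + 1) ^ 2 * max p (Real.log (3 * Fintype.card ι * B * c))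
          / √(Fintype.card ι : ℝ)) := by
  obtain ⟨m, hm⟩ : ∃ m, m = max p (Real.log (3 * Fintype.card ι * B * c)) := ⟨_, rfl⟩
  have hpm : p ≤ m := hm ▸ le_max_left _ _
  have hM1 : (1 : ℝ) ≤ Fintype.card ι := by exact_mod_cast Fintype.card_pos
  obtain ⟨S, hcard, hS⟩ := exists_predictor_net (D := D) h0 h1 hdepth huv.le hc hB ha hb hM1
    (hp.trans hpm) (hm ▸ le_max_right _ _)
  obtain ⟨x, hx⟩ : ∃ x : ℝ, x = depth * ((maxWidth depth l : ℝ) + 1) ^ 2 * m := ⟨_, rfl⟩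
  have hmx : m ≤ x := by
    have hdepth' : (1 : ℝ) ≤ depth := by exact_mod_cast hdepth
    rw [hx]
    exact le_mul_of_one_le_left (by linarith) (one_le_mul_of_one_le_of_one_le hdepth'
      (one_le_pow₀ (le_add_of_nonneg_left (Nat.cast_nonneg _))))
  obtain ⟨G, hGm, hG, hGnorm⟩ := exists_uniform_deviation_of_net huv hX hY hindep hX₀ hY₀ hident
    (F := predictor h0 h1 hdepth huv.le '' {θ : Fin D → ℝ | ∀ i, |θ i| ≤ B})
    (Set.forall_mem_image.2 fun θ _ => measurable_predictor h0 h1 hdepth huv.le θ)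
    (g := fun ϑ : S => predictor h0 h1 hdepth huv.le ϑ.1)
    (fun ϑ => measurable_predictor h0 h1 hdepth huv.le ϑ.1)
    (ε := 1 / (4 * √(Fintype.card ι : ℝ))) (by positivity)
    (Set.forall_mem_image.2 fun θ hθ =>
      have ⟨ϑ, hϑ, h⟩ := hS θ hθ
      ⟨⟨ϑ, hϑ⟩, h⟩)
    hp (q := 2 * x ^ 2) (by nlinarith) (by nlinarith) (by rwa [Fintype.card_coe, hx])
  refine ⟨G, hGm, fun θ hθ => hG _ (Set.mem_image_of_mem _ hθ), hGnorm.trans ?_⟩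
  rw [← hm]
  exact ENNReal.ofReal_le_ofReal ((deviation_const_le (sub_nonneg.2 huv.le)
    (hp.trans (hpm.trans hmx)) _).trans_eq (by rw [hx]; ring))

end UniformDeviation

section ErrorMoments

variable {Ω : Type*} [MeasurableSpace Ω] {P : Measure Ω}

lemma eLpNorm_const_smul_le {f : Ω → ℝ} {q : ENNReal} {r φ : ℝ} (hr : 0 ≤ r)
    (hf : eLpNorm f q P ≤ ENNReal.ofReal φ) :
    eLpNorm (r • f) q P ≤ ENNReal.ofReal (r * φ) := by
  rw [eLpNorm_const_smul, ENNReal.ofReal_mul hr, Real.enorm_of_nonneg hr]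
  gcongr

lemma eLpNorm_le_of_ae_le_affine [IsProbabilityMeasure P] {f g h : Ω → ℝ}
    (hf : AEStronglyMeasurable f P) (hg : AEStronglyMeasurable g P) {e r s φ γ p : ℝ}
    (he : 0 ≤ e) (hr : 0 ≤ r) (hs : 0 ≤ s) (hφ : 0 ≤ φ) (hγ : 0 ≤ γ) (hp : 1 ≤ p)
    (h_nonneg : ∀ ω, 0 ≤ h ω) (h_le : ∀ᵐ ω ∂P, h ω ≤ e + r * f ω + s * g ω)
    (hfφ : eLpNorm f (ENNReal.ofReal p) P ≤ ENNReal.ofReal φ)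
    (hgγ : eLpNorm g (ENNReal.ofReal p) P ≤ ENNReal.ofReal γ) :
    eLpNorm h (ENNReal.ofReal p) P ≤ ENNReal.ofReal (e + r * φ + s * γ) := by
  have hp1 : 1 ≤ ENNReal.ofReal p := ENNReal.one_le_ofReal.2 hp
  have hrf : AEStronglyMeasurable (r • f) P := hf.const_smul r
  have hsg : AEStronglyMeasurable (s • g) P := hg.const_smul s
  calc eLpNorm h (ENNReal.ofReal p) P
    _ ≤ eLpNorm ((fun _ => e) + r • f + s • g) (ENNReal.ofReal p) P :=
        eLpNorm_mono_ae (h_le.mono fun ω hω => by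
          rw [Real.norm_of_nonneg (h_nonneg ω)]
          exact hω.trans (Real.le_norm_self _))
    _ ≤ eLpNorm (fun _ => e) (ENNReal.ofReal p) P + eLpNorm (r • f) (ENNReal.ofReal p) P
          + eLpNorm (s • g) (ENNReal.ofReal p) P :=
        (eLpNorm_add_le (aestronglyMeasurable_const.add hrf) hsg hp1).trans
          (add_le_add_left (eLpNorm_add_le aestronglyMeasurable_const hrf hp1) _)
    _ ≤ ENNReal.ofReal e + ENNReal.ofReal (r * φ) + ENNReal.ofReal (s * γ) :=
        add_le_add (add_le_add (eLpNorm_const_ofReal he (zero_lt_one.trans_le hp)).le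
          (eLpNorm_const_smul_le hr hfφ)) (eLpNorm_const_smul_le hs hgγ)
    _ = ENNReal.ofReal (e + r * φ + s * γ) := by
        rw [← ENNReal.ofReal_add he (by positivity), ← ENNReal.ofReal_add (by positivity)
          (by positivity)]

lemma integral_rpow_le_of_eLpNorm_le [IsProbabilityMeasure P] {f : Ω → ℝ} (hf0 : ∀ ω, 0 ≤ f ω)
    (hf : Measurable f) {p q r : ℝ} (hp : 0 < p) (hpq : p ≤ q) (hr : 0 ≤ r)
    (h : eLpNorm f (ENNReal.ofReal q) P ≤ ENNReal.ofReal r) :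
    (∫ ω, f ω ^ p ∂P) ^ (1 / p) ≤ r := by
  replace h := (eLpNorm_le_eLpNorm_of_exponent_le (ENNReal.ofReal_le_ofReal hpq)
    hf.aestronglyMeasurable).trans h
  rw [eLpNorm_eq_lintegral_rpow_enorm_toReal (by simpa using hp) ENNReal.ofReal_ne_top,
    ENNReal.toReal_ofReal hp.le] at h
  have heq : ∫ ω, f ω ^ p ∂P = (∫⁻ ω, ‖f ω‖ₑ ^ p ∂P).toReal := by
    rw [integral_eq_lintegral_of_nonneg_ae (.of_forall fun ω => Real.rpow_nonneg (hf0 ω) p)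
      (hf.pow_const p).aestronglyMeasurable]
    simp only [Real.enorm_of_nonneg (hf0 _), ENNReal.ofReal_rpow_of_nonneg (hf0 _) hp.le]
  rw [heq, ENNReal.toReal_rpow]
  exact ENNReal.toReal_le_of_le_ofReal hr h

end ErrorMoments

section Selection

lemma measurable_apply_countable_index {Ω ι β : Type*} [MeasurableSpace Ω] [MeasurableSpace ι]
    [MeasurableSpace β] [Countable ι] [MeasurableSingletonClass ι] {f : ι → Ω → β}
    (hf : ∀ i, Measurable (f i)) {κ : Ω → ι} (hκ : Measurable κ) :
    Measurable fun ω => f (κ ω) ω :=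
  (measurable_from_prod_countable_right (f := fun z : ι × Ω => f z.1 z.2) hf).comp
    (hκ.prodMk measurable_id)

lemma card_coe_Icc_one (n : ℕ) : Fintype.card (Finset.Icc 1 n) = n := by
  simp


lemma norm_le_of_mem_cube {n : ℕ} {B : ℝ} (hB : 0 ≤ B) {θ : Fin n → ℝ} (hθ : θ ∈ cube n (-B) B) :
    ‖θ‖ ≤ B :=
  (pi_norm_le_iff_of_nonneg hB).2 fun i => abs_le.2 ⟨hθ.1 i, hθ.2 i⟩

lemma continuous_of_lipschitz_l1 {d : ℕ} {a b u v L : ℝ} (hL : 0 ≤ L)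
    {E : cube d a b → Set.Icc u v} (hLip : ∀ x y : cube d a b,
      |(E x : ℝ) - (E y : ℝ)| ≤ L * ∑ i : Fin d, |(x : Fin d → ℝ) i - (y : Fin d → ℝ) i|) :
    Continuous E := by
  refine (LipschitzWith.of_dist_le_mul (K := (L * d).toNNReal) fun x y => ?_).continuous
  rw [Real.coe_toNNReal _ (by positivity), mul_assoc]
  refine (hLip x y).trans (mul_le_mul_of_nonneg_left ?_ hL)
  exact (Finset.sum_le_card_nsmul _ _ (dist x y) fun i _ =>
    dist_le_pi_dist (x : Fin d → ℝ) y i).trans (by simp)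

lemma optimization_const_le {depth w n : ℕ} {t c p K : ℝ} (ht : 0 ≤ t) (hc : 0 ≤ c) (hp : 0 ≤ p)
    (hK : 1 ≤ K) (hn : 1 ≤ n) (hnw : n ≤ depth * (w * (w + 1))) :
    2 * t * (depth * ((w : ℝ) + 1) ^ depth * c ^ depth) * (2 * c * p / K ^ (n : ℝ)⁻¹)
      ≤ 4 * t * depth * ((w : ℝ) + 1) ^ depth * c ^ (depth + 1) * p
        / K ^ ((depth : ℝ)⁻¹ * (((w : ℝ) + 1) ^ 2)⁻¹) := by
  have hnw' : (n : ℝ) ≤ depth * ((w : ℝ) + 1) ^ 2 := by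
    exact_mod_cast hnw.trans (Nat.mul_le_mul_left _ (by nlinarith))
  have hexp : (depth : ℝ)⁻¹ * (((w : ℝ) + 1) ^ 2)⁻¹ ≤ (n : ℝ)⁻¹ := by
    rw [← mul_inv]
    exact inv_anti₀ (by exact_mod_cast hn) hnw'
  calc 2 * t * (depth * ((w : ℝ) + 1) ^ depth * c ^ depth) * (2 * c * p / K ^ (n : ℝ)⁻¹)
    _ = 4 * t * depth * ((w : ℝ) + 1) ^ depth * c ^ (depth + 1) * p / K ^ (n : ℝ)⁻¹ := by ring
    _ ≤ _ := by gcongr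

lemma empRisk_predictor_Icc {Ω : Type*} {D d depth M : ℕ} {l : ℕ → ℕ} {a b u v : ℝ}
    (h0 : l 0 = d) (h1 : l depth = 1) (hdepth : 1 ≤ depth) (huv : u ≤ v)
    (X : ℕ → Ω → cube d a b) (Y : ℕ → Ω → Set.Icc u v) (θ : Fin D → ℝ) (ω : Ω) :
    empRisk (fun j : Finset.Icc 1 M => X j) (fun j : Finset.Icc 1 M => Y j)
        (predictor h0 h1 hdepth huv θ) ω
      = 1 / (M : ℝ) * ∑ j ∈ Finset.Icc 1 M, |realNN h0 h1 u v θ (X j ω) - (Y j ω : ℝ)| ^ 2 := by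
  rw [empRisk, card_coe_Icc_one, ← Finset.sum_coe_sort (Finset.Icc 1 M)]
  rfl

variable {Ω : Type*} [MeasurableSpace Ω] {P : Measure Ω} [IsProbabilityMeasure P]
  {D d depth : ℕ} {l : ℕ → ℕ} {a b u v : ℝ} (h0 : l 0 = d) (h1 : l depth = 1)
  (hdepth : 1 ≤ depth) {ι κ : Type*} [Fintype ι] [Nonempty ι] [Fintype κ] [Nonempty κ]
  {X : ι → Ω → cube d a b} {Y : ι → Ω → Set.Icc u v} {X₀ : Ω → cube d a b} {Y₀ : Ω → Set.Icc u v}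
  {E : cube d a b → Set.Icc u v}

lemma sqError_le_add_of_empRisk_le (huv : u ≤ v) (hX₀ : Measurable X₀) (hY₀ : Measurable Y₀)
    (hEm : Measurable E) (hE : (fun ω => (E (X₀ ω) : ℝ)) =ᵐ[P]
      P[fun ω => (Y₀ ω : ℝ) | MeasurableSpace.comap X₀ inferInstance])
    {c γ : ℝ} (hc : 1 ≤ c) (ha : |a| ≤ c) (hb : |b| ≤ c) {ω : Ω} {θ θ' ϑ : Fin D → ℝ}
    (hθ : |empRisk X Y (predictor h0 h1 hdepth huv θ) ω
      - risk P X₀ Y₀ (predictor h0 h1 hdepth huv θ)| ≤ γ)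
    (hϑ : |empRisk X Y (predictor h0 h1 hdepth huv ϑ) ω
      - risk P X₀ Y₀ (predictor h0 h1 hdepth huv ϑ)| ≤ γ)
    (hθθ' : empRisk X Y (predictor h0 h1 hdepth huv θ) ω
      ≤ empRisk X Y (predictor h0 h1 hdepth huv θ') ω)
    (hθ'c : ∀ i, |θ' i| ≤ c) (hϑc : ∀ i, |ϑ i| ≤ c) :
    sqError h0 h1 E (P.map X₀) θ ≤ sqError h0 h1 E (P.map X₀) ϑ + 2 * γ
      + 2 * (v - u) * (depth * ((maxWidth depth l : ℝ) + 1) ^ depth * c ^ depth)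
        * headDist (numParams l depth) ϑ θ' := by
  have hsq (θ : Fin D → ℝ) : sqError h0 h1 E (P.map X₀) θ
      = ∫ x, |(predictor h0 h1 hdepth huv θ x : ℝ) - E x| ^ 2 ∂(P.map X₀) := rfl
  rw [hsq, hsq, ← pow_sub_one_mul (Nat.one_le_iff_ne_zero.1 hdepth) c]
  refine (integral_le_add_of_empRisk_le huv hX₀ hY₀ (measurable_predictor h0 h1 hdepth huv θ)
    (measurable_predictor h0 h1 hdepth huv ϑ) hEm hE hθ hϑ hθθ'
    (abs_predictor_sub_predictor_le h0 h1 hdepth huv hc hc ha hb hθ'c hϑc (headDist_nonneg _ ϑ θ')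
      fun _ => abs_param_sub_le_headDist)).trans_eq ?_
  ring

lemma ae_sqError_le (huv : u ≤ v) (hX₀ : Measurable X₀) (hY₀ : Measurable Y₀)
    (hEm : Measurable E) (hE : (fun ω => (E (X₀ ω) : ℝ)) =ᵐ[P]
      P[fun ω => (Y₀ ω : ℝ) | MeasurableSpace.comap X₀ inferInstance])
    {c B : ℝ} (hc : 1 ≤ c) (hcB : c ≤ B) (ha : |a| ≤ c) (hb : |b| ≤ c) {G : Ω → ℝ}
    (hG : ∀ θ : Fin D → ℝ, (∀ i, |θ i| ≤ B) → ∀ ω,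
      |empRisk X Y (predictor h0 h1 hdepth huv θ) ω
        - risk P X₀ Y₀ (predictor h0 h1 hdepth huv θ)| ≤ G ω)
    {ϑ : Fin D → ℝ} (hϑ : ∀ i, |ϑ i| ≤ c) {Θ : κ → Ω → Fin D → ℝ} (hΘ : ∀ k, Measurable (Θ k))
    (hunif : ∀ k, P.map (Θ k) = (volume : Measure (Fin D → ℝ))[|cube D (-c) c])
    {T : Ω → Fin D → ℝ} (hTB : ∀ ω i, |T ω i| ≤ B)
    (hTmin : ∀ ω k, empRisk X Y (predictor h0 h1 hdepth huv (T ω)) ω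
      ≤ empRisk X Y (predictor h0 h1 hdepth huv (Θ k ω)) ω) :
    ∀ᵐ ω ∂P, sqError h0 h1 E (P.map X₀) (T ω) ≤ sqError h0 h1 E (P.map X₀) ϑ + 2 * G ω
      + 2 * (v - u) * (depth * ((maxWidth depth l : ℝ) + 1) ^ depth * c ^ depth)
        * Finset.univ.inf' Finset.univ_nonempty fun k =>
            headDist (numParams l depth) ϑ (Θ k ω) := by
  have hcube : ∀ᵐ ω ∂P, ∀ k, Θ k ω ∈ cube D (-c) c := ae_all_iff.2 fun k =>
    ae_of_ae_map (hΘ k).aemeasurable (by rw [hunif k]; exact ae_cond_mem measurableSet_Icc)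
  filter_upwards [hcube] with ω hω
  obtain ⟨k, -, hk⟩ := Finset.exists_mem_eq_inf' (Finset.univ_nonempty (α := κ)) fun k =>
    headDist (numParams l depth) ϑ (Θ k ω)
  rw [hk]
  exact sqError_le_add_of_empRisk_le h0 h1 hdepth huv hX₀ hY₀ hEm hE hc ha hb
    (hG (T ω) (hTB ω) ω) (hG ϑ (fun i => (hϑ i).trans hcB) ω) (hTmin ω k)
    (fun i => abs_le.2 ⟨(hω k).1 i, (hω k).2 i⟩) hϑ

theorem eLpNorm_sqError_le (huv : u < v) (hparams : numParams l depth ≤ D)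
    (hX : ∀ j, Measurable (X j)) (hY : ∀ j, Measurable (Y j))
    (hindep : iIndepFun (fun j ω => (X j ω, Y j ω)) P) (hX₀ : Measurable X₀) (hY₀ : Measurable Y₀)
    (hident : ∀ j, IdentDistrib (fun ω => (X j ω, Y j ω)) (fun ω => (X₀ ω, Y₀ ω)) P P)
    (hEm : Measurable E) (hE : (fun ω => (E (X₀ ω) : ℝ)) =ᵐ[P]
      P[fun ω => (Y₀ ω : ℝ) | MeasurableSpace.comap X₀ inferInstance])
    {c B p ε : ℝ} (hc : 1 ≤ c) (hcB : c ≤ B) (ha : |a| ≤ c) (hb : |b| ≤ c) (hp : 1 ≤ p)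
    {ϑ : Fin D → ℝ} (hϑ : ∀ i, |ϑ i| ≤ c) (hϑε : sqError h0 h1 E (P.map X₀) ϑ ≤ ε)
    {Θ : κ → Ω → Fin D → ℝ} (hΘ : ∀ k, Measurable (Θ k)) (hΘindep : iIndepFun Θ P)
    (hunif : ∀ k, P.map (Θ k) = (volume : Measure (Fin D → ℝ))[|cube D (-c) c])
    {T : Ω → Fin D → ℝ} (hTB : ∀ ω i, |T ω i| ≤ B)
    (hTmin : ∀ ω k, empRisk X Y (predictor h0 h1 hdepth huv.le (T ω)) ω
      ≤ empRisk X Y (predictor h0 h1 hdepth huv.le (Θ k ω)) ω) :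
    eLpNorm (fun ω => sqError h0 h1 E (P.map X₀) (T ω)) (ENNReal.ofReal p) P
      ≤ ENNReal.ofReal (ε
        + 4 * (v - u) * depth * ((maxWidth depth l : ℝ) + 1) ^ depth * c ^ (depth + 1) * p
            / (Fintype.card κ : ℝ) ^ ((depth : ℝ)⁻¹ * (((maxWidth depth l : ℝ) + 1) ^ 2)⁻¹)
        + 18 * max 1 ((v - u) ^ 2) * depth * ((maxWidth depth l : ℝ) + 1) ^ 2
            * max p (Real.log (3 * Fintype.card ι * B * c)) / √(Fintype.card ι : ℝ)) := by
  have hc0 : 0 < c := zero_lt_one.trans_le hc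
  have hvu : 0 ≤ v - u := sub_nonneg.2 huv.le
  have hK : (1 : ℝ) ≤ Fintype.card κ := by exact_mod_cast Fintype.card_pos
  have hnp : 1 ≤ numParams l depth := one_le_numParams h1 hdepth
  obtain ⟨G, hGm, hG, hGnorm⟩ := exists_uniform_deviation (D := D) h0 h1 hdepth huv hX hY
    hindep hX₀ hY₀ hident hc (hc.trans hcB) ha hb hp
  have hmin := eLpNorm_min_headDist_le hΘ hΘindep hc0 hunif hnp hparams hϑ hp
  have hminm : Measurable fun ω => Finset.univ.inf' Finset.univ_nonempty fun k =>
      headDist (numParams l depth) ϑ (Θ k ω) :=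
    measurable_inf' fun k => (continuous_headDist _ ϑ).measurable.comp (hΘ k)
  have : 0 ≤ max p (Real.log (3 * Fintype.card ι * B * c)) := le_max_of_le_left (by linarith)
  refine (eLpNorm_le_of_ae_le_affine hGm.aestronglyMeasurable hminm.aestronglyMeasurable
    (sqError_nonneg h0 h1 E _ ϑ) zero_le_two (by positivity) (by positivity) (by positivity) hp
    (fun ω => sqError_nonneg h0 h1 E _ (T ω)) (ae_sqError_le h0 h1 hdepth huv.le hX₀ hY₀ hEm hE hc
      hcB ha hb hG hϑ hΘ hunif hTB hTmin) hGnorm hmin).trans (ENNReal.ofReal_le_ofReal ?_)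
  linear_combination hϑε + optimization_const_le hvu hc0.le (zero_le_one.trans hp) hK hnp
    (numParams_le l depth)

end Selection

section Constants

lemma log_three_add_two_mul_log_le {B : ℝ} (hB : 0 < B) :
    Real.log 3 + 2 * Real.log B ≤ 23 / 18 * B := by
  have hconst : 3 * (36 / 23) ^ 2 ≤ Real.exp 2 := by
    have hexp : Real.exp 2 = Real.exp 1 ^ 2 := by rw [← Real.exp_nat_mul]; norm_num
    nlinarith [Real.exp_one_gt_d9]
  have htangent : Real.log (23 / 36 * B) ≤ 23 / 36 * B - 1 :=
    Real.log_le_sub_one_of_pos (by positivity)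
  calc Real.log 3 + 2 * Real.log B
    _ = Real.log (3 * (36 / 23) ^ 2) + 2 * Real.log (23 / 36 * B) := by
        rw [Real.log_mul, Real.log_mul, Real.log_pow, ← inv_div 23 36, Real.log_inv]
        · ring
        all_goals positivity
    _ ≤ 2 + 2 * (23 / 36 * B - 1) := by
        gcongr
        exact (Real.log_le_iff_le_exp (by norm_num)).2 hconst
    _ = 23 / 18 * B := by ring

lemma max_log_le {M B c p : ℝ} (hM : 1 ≤ M) (hc : 1 ≤ c) (hcB : c ≤ B) :
    18 * max p (Real.log (3 * M * B * c)) ≤ 23 * B * max p (Real.log (Real.exp 1 * M)) := by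
  have hB : 1 ≤ B := hc.trans hcB
  obtain ⟨y, hy⟩ : ∃ y, y = max p (Real.log (Real.exp 1 * M)) := ⟨_, rfl⟩
  have hpy : p ≤ y := hy ▸ le_max_left _ _
  have hlogy : 1 + Real.log M ≤ y := by
    rw [hy, Real.log_mul (Real.exp_ne_zero 1) (by positivity), Real.log_exp]
    exact le_max_right _ _
  have hlogM : 0 ≤ Real.log M := Real.log_nonneg hM
  rw [← hy, ← le_div_iff₀' (by norm_num)]
  refine max_le (by nlinarith) ?_
  calc Real.log (3 * M * B * c)
    _ ≤ Real.log (3 * M * B * B) := Real.log_le_log (by positivity) (by gcongr)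
    _ = Real.log M + (Real.log 3 + 2 * Real.log B) := by
        rw [Real.log_mul, Real.log_mul, Real.log_mul]
        · ring
        all_goals positivity
    _ ≤ Real.log M + 23 / 18 * B := by
        gcongr
        exact log_three_add_two_mul_log_le (by positivity)
    _ ≤ 23 * B * (1 + Real.log M) / 18 := by nlinarith
    _ ≤ 23 * B * y / 18 := by gcongr

lemma max_max_one_log_eq {M B c : ℝ} (hM : 1 ≤ M) (hB : 1 ≤ B) (hc : 1 ≤ c) (p : ℝ) :
    max (max 1 p) (Real.log (3 * M * B * c)) = max p (Real.log (3 * M * B * c)) := by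
  have hlog : 1 ≤ Real.log (3 * M * B * c) := by
    rw [Real.le_log_iff_exp_le (by positivity)]
    calc Real.exp 1 ≤ 3 * 1 * 1 * 1 := by linarith [Real.exp_one_lt_d9]
      _ ≤ 3 * M * B * c := by gcongr
  rw [max_comm 1 p, max_assoc, max_eq_right hlog]

lemma approximation_const_sq {A : ℝ} (hA : 0 ≤ A) (d : ℕ) (L r : ℝ) :
    (3 * d * L * r / A ^ ((1 : ℝ) / d)) ^ 2
      = 9 * (d : ℝ) ^ 2 * L ^ 2 * r ^ 2 / A ^ ((2 : ℝ) / d) := by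
  rw [div_pow, ← Real.rpow_mul_natCast hA]
  ring_nf

lemma approximation_term_le {d : ℕ} {A L a b c : ℝ} (hA : 0 ≤ A) (hL : 0 ≤ L) (hLc : L ≤ c)
    (hab : a ≤ b) (ha : |a| ≤ c) (hb : |b| ≤ c) :
    9 * (d : ℝ) ^ 2 * L ^ 2 * (b - a) ^ 2 / A ^ ((2 : ℝ) / d)
      ≤ 36 * (d : ℝ) ^ 2 * c ^ 4 / A ^ ((2 : ℝ) / d) := by
  have hba : b - a ≤ 2 * c := by linarith [le_of_abs_le hb, neg_le_of_abs_le ha]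
  have : 0 ≤ b - a := sub_nonneg.2 hab
  calc 9 * (d : ℝ) ^ 2 * L ^ 2 * (b - a) ^ 2 / A ^ ((2 : ℝ) / d)
    _ ≤ 9 * (d : ℝ) ^ 2 * c ^ 2 * (2 * c) ^ 2 / A ^ ((2 : ℝ) / d) := by gcongr
    _ = 36 * (d : ℝ) ^ 2 * c ^ 4 / A ^ ((2 : ℝ) / d) := by ring

lemma optimization_term_le {depth : ℕ} {t c w m r : ℝ} (htc : t ≤ c) (hc : 0 ≤ c) (hw : 0 ≤ w)
    (hm : 0 ≤ m) (hr : 0 ≤ r) :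
    4 * t * depth * w ^ depth * c ^ (depth + 1) * m / r
      ≤ 4 * depth * w ^ depth * c ^ (depth + 2) * m / r :=
  calc 4 * t * depth * w ^ depth * c ^ (depth + 1) * m / r
    _ ≤ 4 * c * depth * w ^ depth * c ^ (depth + 1) * m / r := by gcongr
    _ = 4 * depth * w ^ depth * c ^ (depth + 2) * m / r := by ring

lemma generalization_term_le {depth : ℕ} {t w M B c p : ℝ} (ht : 0 ≤ t) (htc : t ≤ c)
    (hM : 1 ≤ M) (hc : 1 ≤ c) (hcB : c ≤ B) (hp : 0 ≤ p) :
    18 * max 1 (t ^ 2) * depth * w ^ 2 * max p (Real.log (3 * M * B * c)) / √M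
      ≤ 23 * B ^ 3 * depth * w ^ 2 * max p (Real.log (Real.exp 1 * M)) / √M := by
  have htB : max 1 (t ^ 2) ≤ B ^ 2 :=
    max_le (one_le_pow₀ (hc.trans hcB)) (pow_le_pow_left₀ ht (htc.trans hcB) 2)
  have : 0 ≤ max p (Real.log (3 * M * B * c)) := le_max_of_le_left hp
  calc 18 * max 1 (t ^ 2) * depth * w ^ 2 * max p (Real.log (3 * M * B * c)) / √M
    _ ≤ 18 * B ^ 2 * depth * w ^ 2 * max p (Real.log (3 * M * B * c)) / √M := by gcongr
    _ = B ^ 2 * depth * w ^ 2 * (18 * max p (Real.log (3 * M * B * c))) / √M := by ring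
    _ ≤ B ^ 2 * depth * w ^ 2 * (23 * B * max p (Real.log (Real.exp 1 * M))) / √M := by
        gcongr B ^ 2 * depth * w ^ 2 * ?_ / √M
        exact max_log_le hM hc hcB
    _ = 23 * B ^ 3 * depth * w ^ 2 * max p (Real.log (Real.exp 1 * M)) / √M := by ring

end Constants

end ClippedDNN

theorem theorem5p6_general {d D depth M K : ℕ} (hd : 1 ≤ d) (hdepth : 1 ≤ depth) (hM : 1 ≤ M)
    (hK : 1 ≤ K) {A L a b u v c B : ℝ} (hA : 0 < A) (hab : a < b) (huv : u < v)
    (hc : max 1 (max L (max |a| (max |b| (max (2 * |u|) (2 * |v|))))) ≤ c) (hB : c ≤ B)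
    {l : ℕ → ℕ}
    (hdepthA : A * (Set.Ioi ((6 : ℝ) ^ d)).indicator 1 A / (2 * d) + 1 ≤ (depth : ℝ))
    (h0 : l 0 = d) (hl1 : A * (Set.Ioi ((6 : ℝ) ^ d)).indicator 1 A ≤ (l 1 : ℝ))
    (h1 : l depth = 1) (hparams : numParams l depth ≤ D)
    (hli : ∀ i : ℕ, 2 ≤ i → i < depth →
      (Set.Ioi ((6 : ℝ) ^ d)).indicator 1 A * max (A / d - 2 * i + 3) 2 ≤ (l i : ℝ))
    {Ω : Type*} [MeasurableSpace Ω] {P : Measure Ω} [IsProbabilityMeasure P]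
    {X : ℕ → Ω → cube d a b} {Y : ℕ → Ω → Set.Icc u v}
    (hX : ∀ j ∈ Finset.Icc 1 M, Measurable (X j)) (hY : ∀ j ∈ Finset.Icc 1 M, Measurable (Y j))
    (hXYindep : iIndepFun (fun (j : Finset.Icc 1 M) ω => (X j ω, Y j ω)) P)
    (hXYident : ∀ j ∈ Finset.Icc 1 M,
      IdentDistrib (fun ω => (X j ω, Y j ω)) (fun ω => (X 1 ω, Y 1 ω)) P P)
    {E : cube d a b → Set.Icc u v}
    (hE : (fun ω => (E (X 1 ω) : ℝ)) =ᵐ[P]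
      P[fun ω => (Y 1 ω : ℝ) | MeasurableSpace.comap (X 1) inferInstance])
    (hLip : ∀ x y : cube d a b,
      |(E x : ℝ) - (E y : ℝ)| ≤ L * ∑ i : Fin d, |(x : Fin d → ℝ) i - (y : Fin d → ℝ) i|)
    {Θ : ℕ → Ω → Fin D → ℝ} (hΘ : ∀ k ∈ Finset.Icc 1 K, Measurable (Θ k))
    (hΘindep : iIndepFun (fun (k : Finset.Icc 1 K) => Θ k) P)
    (hΘident : ∀ k ∈ Finset.Icc 1 K, IdentDistrib (Θ k) (Θ 1) P P)
    (hΘunif : pdf.IsUniform (Θ 1) (cube D (-c) c) P volume)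
    {R : (Fin D → ℝ) → Ω → ℝ}
    (hR : ∀ θ ω, R θ ω =
      1 / (M : ℝ) * ∑ j ∈ Finset.Icc 1 M, |realNN h0 h1 u v θ (X j ω) - (Y j ω : ℝ)| ^ 2)
    {T : Ω → Fin D → ℝ} (hT : Measurable T) (hTB : ∀ ω, ‖T ω‖ ≤ B)
    (hTmin : ∀ ω, ∀ k ∈ Finset.Icc 1 K, R (T ω) ω ≤ R (Θ k ω) ω) :
    (∀ θ : Fin D → ℝ,
      Integrable (fun x : cube d a b => |realNN h0 h1 u v θ x - (E x : ℝ)| ^ 2) (P.map (X 1))) ∧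
    Measurable (fun ω => sqError h0 h1 E (P.map (X 1)) (T ω)) ∧
    ∀ p : ℝ, 0 < p →
      Integrable (fun ω => sqError h0 h1 E (P.map (X 1)) (T ω) ^ p) P ∧
      (∫ ω, sqError h0 h1 E (P.map (X 1)) (T ω) ^ p ∂P) ^ (1 / p)
        ≤ 9 * (d : ℝ) ^ 2 * L ^ 2 * (b - a) ^ 2 / A ^ ((2 : ℝ) / d)
          + 4 * (v - u) * depth * ((maxWidth depth l : ℝ) + 1) ^ depth * c ^ (depth + 1) * max 1 p
              / (K : ℝ) ^ ((depth : ℝ)⁻¹ * (((maxWidth depth l : ℝ) + 1) ^ 2)⁻¹)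
          + 18 * max 1 ((v - u) ^ 2) * depth * ((maxWidth depth l : ℝ) + 1) ^ 2
              * max p (Real.log (3 * M * B * c)) / √(M : ℝ) ∧
      9 * (d : ℝ) ^ 2 * L ^ 2 * (b - a) ^ 2 / A ^ ((2 : ℝ) / d)
          + 4 * (v - u) * depth * ((maxWidth depth l : ℝ) + 1) ^ depth * c ^ (depth + 1) * max 1 p
              / (K : ℝ) ^ ((depth : ℝ)⁻¹ * (((maxWidth depth l : ℝ) + 1) ^ 2)⁻¹)
          + 18 * max 1 ((v - u) ^ 2) * depth * ((maxWidth depth l : ℝ) + 1) ^ 2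
              * max p (Real.log (3 * M * B * c)) / √(M : ℝ)
        ≤ 36 * (d : ℝ) ^ 2 * c ^ 4 / A ^ ((2 : ℝ) / d)
          + 4 * depth * ((maxWidth depth l : ℝ) + 1) ^ depth * c ^ (depth + 2) * max 1 p
              / (K : ℝ) ^ ((depth : ℝ)⁻¹ * (((maxWidth depth l : ℝ) + 1) ^ 2)⁻¹)
          + 23 * B ^ 3 * depth * ((maxWidth depth l : ℝ) + 1) ^ 2
              * max p (Real.log (Real.exp 1 * M)) / √(M : ℝ) := by
  simp only [max_le_iff] at hc
  obtain ⟨hc1, hLc, ha, hb, hu, hv⟩ := hc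
  have hM1 : 1 ∈ Finset.Icc 1 M := Finset.left_mem_Icc.2 hM
  have hL : 0 ≤ L := lipschitz_const_nonneg hd hab hLip
  have hEm : Measurable E := (continuous_of_lipschitz_l1 hL hLip).measurable
  have : IsProbabilityMeasure (P.map (X 1)) :=
    Measure.isProbabilityMeasure_map (hX 1 hM1).aemeasurable
  have hTm : Measurable fun ω => sqError h0 h1 E (P.map (X 1)) (T ω) :=
    (measurable_sqError h0 h1 hdepth huv.le hEm).comp hT
  have hM' : (1 : ℝ) ≤ M := by exact_mod_cast hM
  have hvu : 0 ≤ v - u := sub_nonneg.2 huv.le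
  have hvuc : v - u ≤ c := by linarith [le_abs_self v, neg_abs_le u]
  have hc0 : 0 ≤ c := zero_le_one.trans hc1
  refine ⟨fun θ => integrable_abs_sub_sq (measurable_predictor h0 h1 hdepth huv.le θ) hEm, hTm,
    fun p hp => ⟨integrable_sqError_rpow h0 h1 hdepth huv.le hEm hT hp.le, ?_,
      add_le_add_three (approximation_term_le hA.le hL hLc hab.le ha hb)
        (optimization_term_le hvuc hc0 (by positivity) (by positivity) (by positivity))
        (generalization_term_le hvu hvuc hM' hc1 hB hp.le)⟩⟩
  obtain ⟨ϑ, hϑ, hϑE⟩ := exists_params_approx (D := D) h0 h1 hd hdepth hparams hA hab hc1 hLc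
    ha hb hu hv hdepthA hl1 hli hLip
  have : Nonempty (Finset.Icc 1 M) := ⟨⟨1, hM1⟩⟩
  have : Nonempty (Finset.Icc 1 K) := ⟨⟨1, Finset.left_mem_Icc.2 hK⟩⟩
  have hmain := eLpNorm_sqError_le (X := fun j : Finset.Icc 1 M => X j)
    (Y := fun j : Finset.Icc 1 M => Y j) (Θ := fun k : Finset.Icc 1 K => Θ k) h0 h1 hdepth huv
    hparams (fun j => hX j j.2) (fun j => hY j j.2) hXYindep (hX 1 hM1) (hY 1 hM1)
    (fun j => hXYident j j.2) hEm hE hc1 hB ha hb (le_max_left 1 p) hϑ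
    ((sqError_le_sq h0 h1 hϑE).trans_eq (approximation_const_sq hA.le d L _))
    (fun k => hΘ k k.2) hΘindep (fun k => (hΘident k k.2).map_eq.trans hΘunif)
    (fun ω => (pi_norm_le_iff_of_nonneg (hc0.trans hB)).1 (hTB ω))
    (fun ω k => by simpa only [empRisk_predictor_Icc, ← hR] using hTmin ω k k.2)
  rw [card_coe_Icc_one, card_coe_Icc_one, max_max_one_log_eq hM' (hc1.trans hB) hc1] at hmain
  exact integral_rpow_le_of_eLpNorm_le (fun ω => sqError_nonneg h0 h1 E _ (T ω)) hTm hp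
    (le_max_right 1 p) (by positivity) hmain

theorem theorem5p6
    (d D depth M K N : ℕ) (hd : 1 ≤ d) (hD : 1 ≤ D) (hdepth : 1 ≤ depth)
    (hM : 1 ≤ M) (hK : 1 ≤ K) (hN : 1 ≤ N)
    (A L a b u v c B : ℝ) (hA : 0 < A) (hab : a < b) (huv : u < v)
    (hc : max 1 (max L (max |a| (max |b| (max (2 * |u|) (2 * |v|))))) ≤ c) (hB : c ≤ B)
    (l : ℕ → ℕ) (hl : ∀ i ≤ depth, 1 ≤ l i)
    (S : Set ℕ) (hS : S ⊆ Set.Iic N) (hS0 : 0 ∈ S)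
    (hdepthA : A * (Set.Ioi ((6 : ℝ) ^ d)).indicator 1 A / (2 * d) + 1 ≤ (depth : ℝ))
    (h0 : l 0 = d)
    (hl1 : A * (Set.Ioi ((6 : ℝ) ^ d)).indicator 1 A ≤ (l 1 : ℝ))
    (h1 : l depth = 1)
    (hparams : ∑ i ∈ Finset.Icc 1 depth, l i * (l (i - 1) + 1) ≤ D)
    (hli : ∀ i : ℕ, 2 ≤ i → i < depth →
      (Set.Ioi ((6 : ℝ) ^ d)).indicator 1 A * max (A / d - 2 * i + 3) 2 ≤ (l i : ℝ))
    {Ω : Type*} [MeasurableSpace Ω] (P : Measure Ω) [IsProbabilityMeasure P]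
    (X : ℕ → Ω → cube d a b) (Y : ℕ → Ω → Set.Icc u v)
    (hX : ∀ j ∈ Finset.Icc 1 M, Measurable (X j))
    (hY : ∀ j ∈ Finset.Icc 1 M, Measurable (Y j))
    (hXYindep : iIndepFun (fun (j : Finset.Icc 1 M) ω => (X j ω, Y j ω)) P)
    (hXYident : ∀ j ∈ Finset.Icc 1 M,
      IdentDistrib (fun ω => (X j ω, Y j ω)) (fun ω => (X 1 ω, Y 1 ω)) P P)
    (E : cube d a b → Set.Icc u v)
    (hE : (fun ω => (E (X 1 ω) : ℝ)) =ᵐ[P]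
      P[fun ω => (Y 1 ω : ℝ) | MeasurableSpace.comap (X 1) inferInstance])
    (hLip : ∀ x y : cube d a b,
      |(E x : ℝ) - (E y : ℝ)| ≤ L * ∑ i : Fin d, |(x : Fin d → ℝ) i - (y : Fin d → ℝ) i|)
    (Θ : ℕ → ℕ → Ω → Fin D → ℝ) (hΘ : ∀ k n, Measurable (Θ k n))
    (κ : Ω → ℕ × ℕ) (hκ : Measurable κ)
    (hΘB : ∀ k, 1 ≤ k → ∀ ω, Θ k 0 ω ∈ cube D (-B) B)
    (hΘindep : iIndepFun (fun (k : Finset.Icc 1 K) => Θ k 0) P)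
    (hΘident : ∀ k ∈ Finset.Icc 1 K, IdentDistrib (Θ k 0) (Θ 1 0) P P)
    (hΘunif : pdf.IsUniform (Θ 1 0) (cube D (-c) c) P volume)
    (R : (Fin D → ℝ) → Ω → ℝ)
    (hR : ∀ θ ω, R θ ω =
      1 / (M : ℝ) * ∑ j ∈ Finset.Icc 1 M, |realNN h0 h1 u v θ (X j ω) - (Y j ω : ℝ)| ^ 2)
    -- `κ ω` minimises the empirical risk over the admissible indices; the norm on `Fin D → ℝ`
    -- is the maximum norm
    (hκmem : ∀ ω, κ ω ∈
      {q : ℕ × ℕ | q.1 ∈ Finset.Icc 1 K ∧ q.2 ∈ S ∧ ‖Θ q.1 q.2 ω‖ ≤ B})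
    (hκmin : ∀ ω, IsMinOn (fun q : ℕ × ℕ => R (Θ q.1 q.2 ω) ω)
      {q : ℕ × ℕ | q.1 ∈ Finset.Icc 1 K ∧ q.2 ∈ S ∧ ‖Θ q.1 q.2 ω‖ ≤ B} (κ ω)) :
    -- the integrals below are well defined
    (∀ θ : Fin D → ℝ,
      Integrable (fun x : cube d a b => |realNN h0 h1 u v θ x - (E x : ℝ)| ^ 2) (P.map (X 1))) ∧
    Measurable (fun ω => sqError h0 h1 E (P.map (X 1)) (Θ (κ ω).1 (κ ω).2 ω)) ∧
    ∀ p : ℝ, 0 < p →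
      Integrable (fun ω => sqError h0 h1 E (P.map (X 1)) (Θ (κ ω).1 (κ ω).2 ω) ^ p) P ∧
      (∫ ω, sqError h0 h1 E (P.map (X 1)) (Θ (κ ω).1 (κ ω).2 ω) ^ p ∂P) ^ (1 / p)
        ≤ 9 * (d : ℝ) ^ 2 * L ^ 2 * (b - a) ^ 2 / A ^ ((2 : ℝ) / d)
          + 4 * (v - u) * depth * ((maxWidth depth l : ℝ) + 1) ^ depth * c ^ (depth + 1) * max 1 p
              / (K : ℝ) ^ ((depth : ℝ)⁻¹ * (((maxWidth depth l : ℝ) + 1) ^ 2)⁻¹)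
          + 18 * max 1 ((v - u) ^ 2) * depth * ((maxWidth depth l : ℝ) + 1) ^ 2
              * max p (Real.log (3 * M * B * c)) / √(M : ℝ) ∧
      9 * (d : ℝ) ^ 2 * L ^ 2 * (b - a) ^ 2 / A ^ ((2 : ℝ) / d)
          + 4 * (v - u) * depth * ((maxWidth depth l : ℝ) + 1) ^ depth * c ^ (depth + 1) * max 1 p
              / (K : ℝ) ^ ((depth : ℝ)⁻¹ * (((maxWidth depth l : ℝ) + 1) ^ 2)⁻¹)
          + 18 * max 1 ((v - u) ^ 2) * depth * ((maxWidth depth l : ℝ) + 1) ^ 2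
              * max p (Real.log (3 * M * B * c)) / √(M : ℝ)
        ≤ 36 * (d : ℝ) ^ 2 * c ^ 4 / A ^ ((2 : ℝ) / d)
          + 4 * depth * ((maxWidth depth l : ℝ) + 1) ^ depth * c ^ (depth + 2) * max 1 p
              / (K : ℝ) ^ ((depth : ℝ)⁻¹ * (((maxWidth depth l : ℝ) + 1) ^ 2)⁻¹)
          + 23 * B ^ 3 * depth * ((maxWidth depth l : ℝ) + 1) ^ 2
              * max p (Real.log (Real.exp 1 * M)) / √(M : ℝ) := by
  exact theorem5p6_general hd hdepth hM hK hA hab huv hc hB hdepthA h0 hl1 h1 hparams hli hX hY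
    hXYindep hXYident hE hLip (fun k _ => hΘ k 0) hΘindep hΘident hΘunif hR
    (measurable_apply_countable_index (fun q => hΘ q.1 q.2) hκ)
    (fun ω => (hκmem ω).2.2) fun ω k hk => isMinOn_iff.1 (hκmin ω) (k, 0)
      ⟨hk, hS0, norm_le_of_mem_cube ((norm_nonneg _).trans (hκmem ω).2.2)
        (hΘB k (Finset.mem_Icc.1 hk).1 ω)⟩
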